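/- **Setting.** Let $(X,d)$ be a proper geodesic metric space and let $G$ be a non-elementary group (neither finite nor virtually cyclic) acting properly and by isometries on $X$. Fix $o\in X$. For $r\in\mathbb R$ and subgroups $H,K\le G$ put $$\mathrm{gr}_G(r)=\#\{g\in G: d(o,go)\le r\},\qquad \mathrm{gr}_{H,K}(r)=\#\{HgK: \min_{h\in H,k\in K} d(o,hgko)<r\}.$$ We write $f(r)\asymp\omega^r$ if there are $M_0,M_1>0$ with $M_0\omega^r\le f(r)\le M_1\omega^r$ for all $r\ge 1$; $G$ has *purely exponential growth* if $\mathrm{gr}_G(r)\asymp\omega^r$ for some $\omega>1$. The growth rate is $\omega_G=\exp\big(\limsup_{r\to\infty}\tfrac{\log \mathrm{gr}_G(r)}{r}\big)$. **Contraction.** For $A\subseteq X$ let $\pi_A(x)=\{a\in A: d(x,a)=d(x,A)\}$ and $\pi_A(B)=\bigcup_{x\in B}\pi_A(x)$. The set $A$ is *$C$-contracting* if $\mathrm{diam}\,\pi_A(\sigma)\le C$ for every geodesic $\sigma$ with $d(\sigma,A)\ge C$, and *contracting* if it is $C$-contracting for some $C$. A path $\gamma$, defined on a closed interval and parametrized by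 arc length, is a *quasi-geodesic* if there is $\lambda\ge1$ such that $|s-t|\le\lambda d(\gamma(s),\gamma(t))+\lambda$ for all $s,t$. An element $g\in G$ is *contracting* if for some $x\in X$ with $gx\ne x$ and some geodesic $[x,gx]$ the bi-infinite path $\gamma=\bigcup_{n\in\mathbb Z}g^n[x,gx]$ is a contracting quasi-geodesic; $\gamma^{+}$ and $\gamma^-$ denote its positive and negative half-rays. A sequence of subsets $A_n$ of $X$ is *escaping* if $d(o,A_n)\to\infty$. **Boundaries and limit sets.** Let $X\subseteq\overline X$ with boundary $\partial X=\overline X\setminus X$, and let $[\cdot]$ be a partition of $\partial X$; for $A\subseteq\partial X$ let $[A]$ be the union of the classes of the points of $A$. The *limit set* of $H\le G$ is $[\Lambda Ho]$, where $\Lambda Ho\subseteq\partial X$ is the set of accumulation points of $Ho$ in $\partial X$. The subgroup $H$ is of *second type* if $[\Lambda Ho]\subsetneq[\Lambda Go]$. The following two kinds of boundary are considered. * *Horofunction boundary.* $\overline X$ is the closure of $\{b_y:y\in X\}$, $b_y(x)=d(x,y)-d(o,y)$, in the space $C(X,\mathbb R)$ with the compact-open topology ($y\in X$ is identified with $b_y$),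 and two boundary points are in the same class if their difference is a bounded function on $X$. * *Convergence boundary.* $\overline X$ is a compact metrizable space containing $X$ as an open dense subspace, every isometry of $X$ extends to a homeomorphism of $\overline X$, and these extensions preserve the partition $[\cdot]$. A sequence of points $x_n\in X$ *tends to* a class $[\xi]$ if all its accumulation points in $\overline X$ lie in $[\xi]$; a sequence of subsets $A_n\subseteq X$ *tends to* $[\xi]$ if, whenever $n_1<n_2<\cdots$, $a_k\in A_{n_k}$ and $a_k$ converges to a point of $\partial X$, the limit is in $[\xi]$. A class $[\xi]$ is *non-pinched* if for any sequences $x_n,y_n\in X$ tending to $[\xi]$, every sequence of geodesics $[x_n,y_n]$ is escaping. It is required that: (A) for every contracting quasi-geodesic ray $\gamma$ there is a class $[\gamma^+]$ that is closed, such that the constant sequence $\gamma$ tends to $[\gamma^+]$, and every sequence $x_n\in X$ with $d(o,\pi_\gamma(x_n))\to\infty$ tends to $[\gamma^+]$; (B) if $C>0$ and $\gamma_n$ is an escaping sequence of $C$-contracting quasi-geodesics, then for every $p\in X$ the sequence of cones $\Omega_p(\gamma_n)=\{x\in X:\text{some geodesic }[p,x]\text{ meets }\gamma_n\}$ has a subsequence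 tending to a class $[\xi]$, $\xi\in\partial X$; (C) there is a non-pinched class. A contracting element $g\in G$ is called *non-pinched with minimal fixed points* if, for a path $\gamma=\bigcup_n g^n[x,gx]$ as above, each of the classes $[g^{+}]$, $[g^-]$ of the accumulation points in $\partial X$ of $\gamma^{+}$, $\gamma^-$ is a single point and is non-pinched. **Theorem 1.5.** Suppose that either 1. $\partial X$ is the horofunction boundary of $X$ with the finite difference partition and $G$ has a contracting element, or 2. $\partial X$ is a convergence boundary of $X$ and $G$ has a non-pinched contracting element with minimal fixed points. Then for any two subgroups $H,K\le G$ of second type there exist $\delta,r_0>0$ such that $$\mathrm{gr}_{H,K}(r)\ \ge\ \delta\cdot\mathrm{gr}_G(r-r_0)\qquad\text{for all } r>r_0.$$ In particular, if $G$ has purely exponential growth, then $\mathrm{gr}_{H,K}(r)\asymp\omega_G^r$. -/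

import Mathlib

open Filter Topology Set

namespace DoubleCosetGrowth

/-! ### Geodesics, quasi-geodesics and contracting subsets -/

section Geometry

variable {X : Type*} [MetricSpace X]

/-- `σ` is (the image of) a geodesic segment `[x, y]`. -/
def IsGeodesicSegment (σ : Set X) (x y : X) : Prop :=
  ∃ γ : ℝ → X, γ 0 = x ∧ γ (dist x y) = y ∧
    (∀ s ∈ Icc 0 (dist x y), ∀ t ∈ Icc 0 (dist x y), dist (γ s) (γ t) = |s - t|) ∧
    σ = γ '' Icc 0 (dist x y)

/-- Any two points are joined by a geodesic segment. -/
def IsGeodesicSpace (X : Type*) [MetricSpace X] : Prop :=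
  ∀ x y : X, ∃ σ : Set X, IsGeodesicSegment σ x y

/-- The shortest point projection `π_A(x)`, a set of points of `A`. -/
def proj (A : Set X) (x : X) : Set X :=
  {a | a ∈ A ∧ dist x a = Metric.infDist x A}

/-- `A` is `C`-contracting: a geodesic `σ` with `d(σ, A) ≥ C` has a projection to `A` of
diameter at most `C`. -/
def IsContracting (C : ℝ) (A : Set X) : Prop :=
  ∀ (σ : Set X) (x y : X), IsGeodesicSegment σ x y → (∀ p ∈ σ, C ≤ Metric.infDist p A) →
    ∀ p ∈ σ, ∀ q ∈ σ, ∀ u ∈ proj A p, ∀ v ∈ proj A q, dist u v ≤ C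

/-- The path `γ`, defined on the closed interval `I` and parametrized by arc length, is a
`l`-quasi-geodesic: a subpath between parameters `s` and `t`, which has length `|s - t|`, satisfies
`|s - t| ≤ l * d(γ s, γ t) + l`. -/
structure IsQuasiGeodesic (l : ℝ) (γ : ℝ → X) (I : Set ℝ) : Prop where
  one_le : 1 ≤ l
  nonempty : I.Nonempty
  isClosed : IsClosed I
  ordConnected : I.OrdConnected
  unitSpeed : HasUnitSpeedOn γ I
  length_le : ∀ s ∈ I, ∀ t ∈ I, |s - t| ≤ l * dist (γ s) (γ t) + l

/-- A sequence of subsets is escaping if its distance to any point tends to infinity. -/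
def IsEscaping (A : ℕ → Set X) : Prop :=
  ∀ (o : X) (R : ℝ), ∀ᶠ n in atTop, ∀ p ∈ A n, R ≤ dist o p

/-- The cone `Ω_o(A)` of the points `x` such that some geodesic `[o, x]` meets `A`. -/
def cone (o : X) (A : Set X) : Set X :=
  {x | ∃ σ : Set X, IsGeodesicSegment σ o x ∧ (σ ∩ A).Nonempty}

end Geometry

/-! ### Group actions and contracting elements -/

section Action

variable {G X : Type*} [Group G] [MetricSpace X] [MulAction G X]

/-- `G` is neither finite nor virtually cyclic, i.e. no cyclic subgroup has finite index. -/
def IsNonElementary (G : Type*) [Group G] : Prop :=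
  ¬ ∃ Z : Subgroup G, IsCyclic Z ∧ Z.FiniteIndex

/-- `γ : ℝ → X` is the `⟨g⟩`-invariant concatenation `⋃ₙ gⁿ [x, g x]` of the translates of
a geodesic segment `[x, g x]`, parametrized by arc length with `γ 0 = x`. The segment is not
allowed to be trivial (otherwise the concatenation would be a point). -/
structure IsOrbitPath (g : G) (x : X) (γ : ℝ → X) : Prop where
  dist_pos : 0 < dist x (g • x)
  map_zero : γ 0 = x
  geodesic : ∀ s ∈ Icc 0 (dist x (g • x)), ∀ t ∈ Icc 0 (dist x (g • x)),
    dist (γ s) (γ t) = |s - t|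
  equivariant : ∀ t : ℝ, γ (t + dist x (g • x)) = g • γ t

/-- `γ` is a quasi-axis of `g`: a concatenated path `⋃ₙ gⁿ [x, g x]` that is
a contracting quasi-geodesic. -/
def IsQuasiAxis (g : G) (γ : ℝ → X) : Prop :=
  ∃ x : X, IsOrbitPath g x γ ∧ (∃ l : ℝ, IsQuasiGeodesic l γ univ) ∧
    ∃ C : ℝ, 0 < C ∧ IsContracting C (range γ)

/-- Contracting elements of `G`. -/
def IsContractingElement (X : Type*) [MetricSpace X] [MulAction G X] (g : G) : Prop :=
  ∃ γ : ℝ → X, IsQuasiAxis g γ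

end Action

/-! ### Growth functions -/

section Growth

variable (G : Type*) {X : Type*} [Group G] [MetricSpace X] [MulAction G X]

/-- `gr_G(r)`, the number of `g` with `d(o, g o) ≤ r`. -/
noncomputable def growth (o : X) (r : ℝ) : ℕ :=
  {g : G | dist o (g • o) ≤ r}.ncard

variable {G}

/-- `gr_{H,K}(r)`, the number of double cosets `H g K` with `min_{h, k} d(o, h g k o) < r`. -/
noncomputable def doubleCosetGrowth (H K : Subgroup G) (o : X) (r : ℝ) : ℕ :=
  {D : Set G | (∃ g : G, D = DoubleCoset.doubleCoset g (H : Set G) (K : Set G)) ∧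
    ∃ x ∈ D, dist o (x • o) < r}.ncard

variable (G)

/-- `f(r) ≍ w ^ r`. -/
def AsympExp (f : ℝ → ℕ) (w : ℝ) : Prop :=
  ∃ M₀ M₁ : ℝ, 0 < M₀ ∧ 0 < M₁ ∧ ∀ r : ℝ, 1 ≤ r → M₀ * w ^ r ≤ f r ∧ (f r : ℝ) ≤ M₁ * w ^ r

/-- `G` has purely exponential growth. -/
def HasPurelyExponentialGrowth (o : X) : Prop :=
  ∃ w : ℝ, 1 < w ∧ AsympExp (growth G o) w

/-- The growth rate `ω_G`, the exponential of `limsup log gr_G(r) / r`. -/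
noncomputable def growthRate (o : X) : ℝ :=
  Real.exp (limsup (fun r : ℝ => Real.log (growth G o r) / r) atTop)

end Growth

/-! ### Boundaries with a partition, limit sets -/

section Boundary

variable {X Y : Type*} [MetricSpace X] [TopologicalSpace Y]

/-- The boundary of `X` in the closure of its image under `ι : X → Y`. -/
def bdry (ι : X → Y) : Set Y := closure (range ι) \ range ι

/-- The saturation `[A]` of a subset of the boundary, the union of the classes of its points. -/
def saturation {ι : X → Y} (P : Setoid (bdry ι)) (A : Set (bdry ι)) : Set (bdry ι) :=
  {η | ∃ ξ ∈ A, P ξ η}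

/-- The points of the boundary that are accumulated by the subset `A` of `X`. -/
def accPts (ι : X → Y) (A : Set X) : Set (bdry ι) :=
  {ξ | (ξ : Y) ∈ closure (ι '' A)}

variable {G : Type*} [Group G] [MulAction G X]

/-- The limit set `[Λ H o]` of a subgroup. -/
def limitSet {ι : X → Y} (P : Setoid (bdry ι)) (H : Subgroup G) (o : X) : Set (bdry ι) :=
  saturation P (accPts ι ((fun h : G => h • o) '' (H : Set G)))

/-- `H` is of second type: its limit set is a proper subset of the limit set of `G`. -/
def IsSecondType {ι : X → Y} (P : Setoid (bdry ι)) (H : Subgroup G) (o : X) : Prop :=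
  limitSet P H o ⊂ limitSet P (⊤ : Subgroup G) o

/-- The sequence of points `x n` tends to the subset `S` of the boundary (in practice a class):
all its accumulation points in `Y` lie in `S`. -/
def PointsTendTo {ι : X → Y} (x : ℕ → X) (S : Set (bdry ι)) : Prop :=
  ∀ p : Y, MapClusterPt p atTop (fun n => ι (x n)) → ∃ ξ ∈ S, (ξ : Y) = p

/-- The sequence of subsets `A n` tends to the subset `S` of the boundary (in practice a class):
the limit of any sequence of points in (a subsequence of) the `A n` which converges to a point
of the boundary lies in `S`. -/
def SetsTendTo {ι : X → Y} (A : ℕ → Set X) (S : Set (bdry ι)) : Prop :=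
  ∀ (φ : ℕ → ℕ) (a : ℕ → X) (ξ : bdry ι), StrictMono φ → (∀ k, a k ∈ A (φ k)) →
    Tendsto (fun k => ι (a k)) atTop (𝓝 (ξ : Y)) → ξ ∈ S

/-- A subset `S` of the boundary (in practice a class) is non-pinched: geodesics between two
sequences that tend to `S` are escaping. -/
def IsNonPinched {ι : X → Y} (S : Set (bdry ι)) : Prop :=
  ∀ (x y : ℕ → X) (σ : ℕ → Set X), PointsTendTo x S → PointsTendTo y S →
    (∀ n, IsGeodesicSegment (σ n) (x n) (y n)) → IsEscaping σ

/-- `ι : X → Y` is a compactification (for `Y` compact and metrizable) with an isometry-invariant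
partition of its boundary that has the convergence property. -/
structure IsConvergenceCompactification (ι : X → Y) (P : Setoid (bdry ι)) : Prop where
  isOpenEmbedding : IsOpenEmbedding ι
  denseRange : DenseRange ι
  /-- Isometries of `X` extend to homeomorphisms, and these preserve the partition. -/
  isometry_extends : ∀ f : X ≃ᵢ X, ∃ F : Y ≃ₜ Y, (∀ x, F (ι x) = ι (f x)) ∧
    ∀ ξ η ξ' η' : bdry ι, (ξ' : Y) = F ξ → (η' : Y) = F η → (P ξ η ↔ P ξ' η')
  /-- A contracting quasi-geodesic ray tends to a closed class, and so does any sequence of points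
  whose projections to the ray are escaping. -/
  ray_tendsto : ∀ (γ : ℝ → X) (l C : ℝ), 0 ≤ C → IsQuasiGeodesic l γ (Ici 0) →
    IsContracting C (γ '' Ici 0) →
    ∃ ξ : bdry ι, IsClosed (saturation P {ξ}) ∧
      SetsTendTo (fun _ => γ '' Ici 0) (saturation P {ξ}) ∧
      ∀ (o : X) (x : ℕ → X), (∀ R : ℝ, ∀ᶠ n in atTop, ∀ p ∈ proj (γ '' Ici 0) (x n), R ≤ dist o p) →
        PointsTendTo x (saturation P {ξ})
  /-- The cones over an escaping sequence of `C`-contracting quasi-geodesics subconverge to a class. -/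
  cones_tendsto : ∀ (C : ℝ) (γ : ℕ → ℝ → X) (I : ℕ → Set ℝ), 0 < C →
    (∀ n, ∃ l : ℝ, IsQuasiGeodesic l (γ n) (I n)) → (∀ n, IsContracting C (γ n '' I n)) →
    IsEscaping (fun n => γ n '' I n) →
    ∀ o : X, ∃ φ : ℕ → ℕ, StrictMono φ ∧ ∃ ξ : bdry ι,
      SetsTendTo (fun k => cone o (γ (φ k) '' I (φ k))) (saturation P {ξ})
  /-- Non-pinched points exist. -/
  exists_nonPinched : ∃ ξ : bdry ι, IsNonPinched (saturation P {ξ})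

/-- The subset `S` of the boundary is a single point, and it is non-pinched. -/
def IsMinimalNonPinched {ι : X → Y} (S : Set (bdry ι)) : Prop :=
  (∃ ξ : bdry ι, S = {ξ}) ∧ IsNonPinched S

/-- `g` is a non-pinched contracting element with minimal fixed points: the classes `[g⁺]` and
`[g⁻]` of the accumulation points of the two half-rays of a quasi-axis are single points and
non-pinched. -/
def IsMinimalNonPinchedContracting {ι : X → Y} (P : Setoid (bdry ι)) (g : G) : Prop :=
  ∃ γ : ℝ → X, IsQuasiAxis g γ ∧
    IsMinimalNonPinched (saturation P (accPts ι (γ '' Ici 0))) ∧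
    IsMinimalNonPinched (saturation P (accPts ι (γ '' Iic 0)))

end Boundary

/-! ### The horofunction boundary -/

section Horofunction

variable {X : Type*} [MetricSpace X]

/-- The map `y ↦ b_y`, `b_y(x) = d(x, y) - d(o, y)`, to the space of continuous functions with
the compact-open topology. Its boundary `bdry (horo o)` is the horofunction boundary. -/
def horo (o : X) (y : X) : C(X, ℝ) where
  toFun x := dist x y - dist o y
  continuous_toFun := by fun_prop

/-- The finite difference relation on the horofunction boundary. -/
def finiteDifference (o : X) : Setoid (bdry (horo o)) where
  r ξ η := ∃ K : ℝ, ∀ x : X, |(ξ : C(X, ℝ)) x - (η : C(X, ℝ)) x| ≤ K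
  iseqv :=
    { refl := fun ξ => ⟨0, fun x => by simp⟩
      symm := fun {ξ η} ⟨K, hK⟩ => ⟨K, fun x => by rw [abs_sub_comm]; exact hK x⟩
      trans := fun {ξ η ζ} ⟨K, hK⟩ ⟨L, hL⟩ =>
        ⟨K + L, fun x => (abs_sub_le _ _ _).trans (add_le_add (hK x) (hL x))⟩ }

end Horofunction

/-- The two conclusions on the growth of the double cosets of `H` and `K`. -/
def DoubleCosetGrowthComparable {G X : Type*} [Group G] [MetricSpace X] [MulAction G X]
    (H K : Subgroup G) (o : X) : Prop :=
  (∃ δ r₀ : ℝ, 0 < δ ∧ 0 < r₀ ∧ ∀ r : ℝ, r₀ < r →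
    δ * (growth G o (r - r₀) : ℝ) ≤ (doubleCosetGrowth H K o r : ℝ)) ∧
  (HasPurelyExponentialGrowth G o → AsympExp (doubleCosetGrowth H K o) (growthRate G o))

end DoubleCosetGrowth

/-! Fix a contracting element `f` with quasi-axis γ, and compare points of `X` through their
nearest-point projections to the translates of γ. Up to a bounded error, `projDist (range γ) (p⁻¹ •
x) (p⁻¹ • y)` is the distance of the projections of x and y to the translate pγ. The subgroup E =
`powerCommensurator f` contains ⟨f⟩ with finite index, so it is proper. Translates of γ by elements
outside E project to γ with uniformly bounded diameter, and Behrstock's inequality follows.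
`IsProjectionSystem` collects these facts, and the counting uses nothing else
(`IsAxis.exists_isProjectionSystem`).

The second-type hypothesis enters through one consequence: H has bounded projection to some
translate of γ (the two theorems `exists_bounded_projection`). Otherwise let g_n o converge to ξ.
Choose translates u_nγ that pass near g_n o but escape from o (`exists_escaping_translates`), and
k_n in H for which k_n o and o project far apart on u_nγ. Geodesics from o to k_n o then pass near
the projection of o to u_nγ, and k_n o subconverges to the class of ξ: on the horofunction boundary
by comparing distance differences, on a convergence boundary by the axiom on cones. Thus H would
have the full limit set.

For the count, suppose H and K have bounded projections to pγ and qγ. Put a = p s p⁻¹ and b = q s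
q⁻¹ with s a large power of f, and consider g ↦ H a g b K on those g whose own projections to these
axes are bounded. An equality a g' b = h a g b k is a quadrilateral with long sides along axes and
short projections elsewhere. It cannot close unless the conjugates of h and k lie in E
(`not_closed_chain`), which leaves finitely many h and k; hence fibres are bounded, apart from a
finite exceptional set of g. Finally, H and K each have bounded projections to two non-parallel
axes, and every g has bounded projection to one axis of each pair, so four such maps cover G
(`isControlled_univ`). -/

namespace DoubleCosetGrowth

/-! ### The geometry of contracting subsets -/

section ContractingGeometry

variable {X : Type*} [MetricSpace X]

/-- `c` is an isometric embedding of the interval `[a, b]`. -/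
def IsGeodesicOn (c : ℝ → X) (a b : ℝ) : Prop :=
  ∀ s ∈ Icc a b, ∀ t ∈ Icc a b, dist (c s) (c t) = |s - t|

namespace IsGeodesicOn

variable {c : ℝ → X} {a b : ℝ}

lemma mono (h : IsGeodesicOn c a b) {a' b' : ℝ} (ha : a ≤ a') (hb : b' ≤ b) :
    IsGeodesicOn c a' b' :=
  fun s hs t ht => h s ⟨ha.trans hs.1, hs.2.trans hb⟩ t ⟨ha.trans ht.1, ht.2.trans hb⟩

lemma dist_eq (h : IsGeodesicOn c a b) {s t : ℝ} (hs : a ≤ s) (hst : s ≤ t) (ht : t ≤ b) :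
    dist (c s) (c t) = t - s := by
  rw [h s ⟨hs, hst.trans ht⟩ t ⟨hs.trans hst, ht⟩, abs_sub_comm, abs_of_nonneg (by linarith)]

lemma reverse (h : IsGeodesicOn c a b) : IsGeodesicOn (fun t => c (a + b - t)) a b := by
  intro s hs t ht
  rw [h _ ⟨by linarith [hs.2], by linarith [hs.1]⟩ _ ⟨by linarith [ht.2], by linarith [ht.1]⟩,
    abs_sub_comm]
  congr 1; ring

lemma isGeodesicSegment (h : IsGeodesicOn c a b) (hab : a ≤ b) :
    IsGeodesicSegment (c '' Icc a b) (c a) (c b) := by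
  have hd := h.dist_eq le_rfl hab le_rfl
  refine ⟨fun t => c (a + t), by simp, by simp [hd], ?_, ?_⟩
  · rw [hd]
    intro s hs t ht
    rw [h _ ⟨by linarith [hs.1], by linarith [hs.2]⟩ _ ⟨by linarith [ht.1], by linarith [ht.2]⟩]
    congr 1; ring
  · rw [hd]
    ext p
    constructor
    · rintro ⟨t, ht, rfl⟩
      exact ⟨t - a, ⟨by linarith [ht.1], by linarith [ht.2]⟩, by simp⟩
    · rintro ⟨t, ht, rfl⟩
      exact ⟨a + t, ⟨by linarith [ht.1], by linarith [ht.2]⟩, rfl⟩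

lemma continuousOn (h : IsGeodesicOn c a b) : ContinuousOn c (Icc a b) := by
  have : LipschitzOnWith 1 c (Icc a b) := LipschitzOnWith.of_dist_le_mul fun s hs t ht => by
    rw [h s hs t ht, Real.dist_eq]; simp
  exact this.continuousOn

lemma continuousOn_infDist (h : IsGeodesicOn c a b) (A : Set X) :
    ContinuousOn (fun t => Metric.infDist (c t) A) (Icc a b) :=
  (Metric.continuous_infDist_pt A).comp_continuousOn h.continuousOn

lemma smul {G : Type*} [Group G] [MulAction G X] [IsIsometricSMul G X] (h : IsGeodesicOn c a b)
    (g : G) : IsGeodesicOn (fun t => g • c t) a b := fun s hs t ht => by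
  rw [dist_smul, h s hs t ht]

end IsGeodesicOn

lemma IsGeodesicSpace.exists_isGeodesicOn (hX : IsGeodesicSpace X) (x y : X) :
    ∃ c : ℝ → X, c 0 = x ∧ c (dist x y) = y ∧ IsGeodesicOn c 0 (dist x y) := by
  obtain ⟨_, c, h0, h1, h, -⟩ := hX x y
  exact ⟨c, h0, h1, h⟩

lemma exists_mem_proj [ProperSpace X] {A : Set X} (hA : IsClosed A) (hne : A.Nonempty) (x : X) :
    ∃ u, u ∈ proj A x := by
  obtain ⟨u, hu, h⟩ := hA.exists_infDist_eq_dist hne x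
  exact ⟨u, hu, h.symm⟩

variable {A : Set X} {C : ℝ}

lemma IsContracting.dist_le (hA : IsContracting C A) {c : ℝ → X} {a b : ℝ}
    (hc : IsGeodesicOn c a b) (hab : a ≤ b) (hfar : ∀ t ∈ Icc a b, C ≤ Metric.infDist (c t) A)
    {u v : X} (hu : u ∈ proj A (c a)) (hv : v ∈ proj A (c b)) : dist u v ≤ C :=
  hA _ _ _ (hc.isGeodesicSegment hab) (by rintro _ ⟨t, ht, rfl⟩; exact hfar t ht)
    _ ⟨a, left_mem_Icc.2 hab, rfl⟩ _ ⟨b, right_mem_Icc.2 hab, rfl⟩ _ hu _ hv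

/-- A geodesic that meets the `C`-neighbourhood of a `C`-contracting set enters it close to the
projections of its starting point. -/
lemma IsContracting.exists_entry [ProperSpace X] (hA : IsContracting C A) (hcl : IsClosed A)
    (hne : A.Nonempty) (hC : 0 ≤ C) {c : ℝ → X} {a b : ℝ} (hc : IsGeodesicOn c a b) (hab : a ≤ b)
    (hb : Metric.infDist (c b) A ≤ C) :
    ∃ s ∈ Icc a b, Metric.infDist (c s) A ≤ C ∧ ∀ u ∈ proj A (c a), dist (c s) u ≤ 2 * C := by
  have hcont := hc.continuousOn_infDist A
  have hcpt : IsCompact (Icc a b ∩ (fun t => Metric.infDist (c t) A) ⁻¹' Iic C) :=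
    isCompact_Icc.of_isClosed_subset
      (hcont.preimage_isClosed_of_isClosed isClosed_Icc isClosed_Iic) inter_subset_left
  obtain ⟨s, ⟨hs, hsC⟩, hmin⟩ := hcpt.exists_isLeast ⟨b, right_mem_Icc.2 hab, hb⟩
  simp only [mem_preimage, mem_Iic] at hsC
  refine ⟨s, hs, hsC, fun u hu => ?_⟩
  rcases le_or_gt (Metric.infDist (c a) A) C with ha | ha
  · have : s = a := le_antisymm (hmin ⟨left_mem_Icc.2 hab, ha⟩) hs.1
    subst this
    rw [hu.2]; linarith
  -- `s` is the first time at distance at most `C`; before it the geodesic stays far from `A`, so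
  -- the contraction property applies there.
  · have hfar : ∀ t ∈ Icc a s, C ≤ Metric.infDist (c t) A := by
      intro t ht
      by_contra! hlt
      obtain ⟨r, hr, hrC⟩ := intermediate_value_Icc' ht.1
        (hcont.mono (Icc_subset_Icc le_rfl (ht.2.trans hs.2))) ⟨hlt.le, ha.le⟩
      simp only at hrC
      have h1 : s ≤ r := hmin ⟨⟨hr.1, hr.2.trans (ht.2.trans hs.2)⟩, hrC.le⟩
      have h2 : r = t := le_antisymm hr.2 (ht.2.trans h1)
      rw [h2] at hrC
      exact hlt.ne hrC
    obtain ⟨w, hw⟩ := exists_mem_proj hcl hne (c s)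
    have h1 := hA.dist_le (hc.mono le_rfl hs.2) hs.1 hfar hu hw
    have h2 := hw.2
    have h3 := dist_triangle_right (c s) u w
    linarith

lemma IsContracting.exists_exit [ProperSpace X] (hA : IsContracting C A) (hcl : IsClosed A)
    (hne : A.Nonempty) (hC : 0 ≤ C) {c : ℝ → X} {a b : ℝ} (hc : IsGeodesicOn c a b) (hab : a ≤ b)
    (ha : Metric.infDist (c a) A ≤ C) :
    ∃ s ∈ Icc a b, Metric.infDist (c s) A ≤ C ∧ ∀ u ∈ proj A (c b), dist (c s) u ≤ 2 * C := by
  obtain ⟨s, hs, h1, h2⟩ := hA.exists_entry hcl hne hC hc.reverse hab (by simpa using ha)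
  exact ⟨a + b - s, ⟨by linarith [hs.2], by linarith [hs.1]⟩, h1, by simpa using h2⟩

/-- Either the geodesic stays far from `A`, or its entry and exit points are each within `2 * C` of
the projections of the ends. -/
lemma IsContracting.dist_proj_le [ProperSpace X] (hA : IsContracting C A) (hcl : IsClosed A)
    (hne : A.Nonempty) (hC : 0 ≤ C) (hX : IsGeodesicSpace X) {x y u v : X} (hu : u ∈ proj A x)
    (hv : v ∈ proj A y) : dist u v ≤ dist x y + 4 * C := by
  obtain ⟨c, h0, h1, hc⟩ := hX.exists_isGeodesicOn x y
  have hL0 : 0 ≤ dist x y := dist_nonneg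
  generalize dist x y = L at *
  subst h0 h1
  by_cases hfar : ∀ t ∈ Icc 0 L, C ≤ Metric.infDist (c t) A
  · linarith [hA.dist_le hc hL0 hfar hu hv]
  · push Not at hfar
    obtain ⟨t, ht, htC⟩ := hfar
    obtain ⟨s, hs, -, h2⟩ := hA.exists_entry hcl hne hC (hc.mono le_rfl ht.2) ht.1 htC.le
    obtain ⟨r, hr, -, h3⟩ := hA.exists_exit hcl hne hC (hc.mono ht.1 le_rfl) ht.2 htC.le
    have h4 := hc.dist_eq hs.1 (hs.2.trans hr.1) hr.2
    have h5 := dist_triangle4 u (c s) (c r) v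
    have h6 := h2 u hu
    rw [dist_comm] at h6
    linarith [h3 v hv, hs.1, hr.2]

/-- A geodesic between points with distant projections to `A` passes close to these projections. -/
lemma IsContracting.exists_entry_exit [ProperSpace X] (hA : IsContracting C A) (hcl : IsClosed A)
    (hne : A.Nonempty) (hC : 0 ≤ C) {c : ℝ → X} {a b : ℝ} (hc : IsGeodesicOn c a b) (hab : a ≤ b)
    {u v : X} (hu : u ∈ proj A (c a)) (hv : v ∈ proj A (c b)) (huv : C < dist u v) :
    ∃ s t, a ≤ s ∧ s ≤ t ∧ t ≤ b ∧ Metric.infDist (c s) A ≤ C ∧ Metric.infDist (c t) A ≤ C ∧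
      dist (c s) u ≤ 2 * C ∧ dist (c t) v ≤ 2 * C := by
  by_cases hfar : ∀ t ∈ Icc a b, C ≤ Metric.infDist (c t) A
  · exact absurd (hA.dist_le hc hab hfar hu hv) (not_le.2 huv)
  · push Not at hfar
    obtain ⟨t, ht, htC⟩ := hfar
    obtain ⟨s, hs, hs', h2⟩ := hA.exists_entry hcl hne hC (hc.mono le_rfl ht.2) ht.1 htC.le
    obtain ⟨r, hr, hr', h3⟩ := hA.exists_exit hcl hne hC (hc.mono ht.1 le_rfl) ht.2 htC.le
    exact ⟨s, r, hs.1, hs.2.trans hr.1, hr.2, hs', hr', h2 u hu, h3 v hv⟩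

/-- Contracting sets are quasi-convex. -/
lemma IsContracting.infDist_le [ProperSpace X] (hA : IsContracting C A) (hcl : IsClosed A)
    (hne : A.Nonempty) (hC : 0 ≤ C) {c : ℝ → X} {a b : ℝ} (hc : IsGeodesicOn c a b)
    (ha : Metric.infDist (c a) A ≤ C) (hb : Metric.infDist (c b) A ≤ C) {t : ℝ}
    (ht : t ∈ Icc a b) : Metric.infDist (c t) A ≤ 5 * C := by
  -- The exit before `t` and the entry after `t` both lie within `2 * C` of `w`, so `c t` is within
  -- `4 * C` of a point of the `C`-neighbourhood.
  obtain ⟨w, hw⟩ := exists_mem_proj hcl hne (c t)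
  obtain ⟨s, hs, hs', h2⟩ := hA.exists_entry hcl hne hC (hc.mono ht.1 le_rfl) ht.2 hb
  obtain ⟨r, hr, -, h3⟩ := hA.exists_exit hcl hne hC (hc.mono le_rfl ht.2) ht.1 ha
  have h4 := hc.dist_eq hr.1 (hr.2.trans hs.1) hs.2
  have h5 := hc.dist_eq ht.1 hs.1 hs.2
  have h6 := dist_triangle_right (c r) (c s) w
  have h7 := Metric.infDist_le_infDist_add_dist (s := A) (x := c t) (y := c s)
  linarith [h2 w hw, h3 w hw, hr.2]

/-- A point of `A` closer to `c t` than `c b` is would also be closer to `c a`. -/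
lemma mem_proj_of_isGeodesicOn {c : ℝ → X} {a b t : ℝ} (hc : IsGeodesicOn c a b)
    (ht : t ∈ Icc a b) (hb : c b ∈ proj A (c a)) : c b ∈ proj A (c t) := by
  refine ⟨hb.1, le_antisymm ?_ (Metric.infDist_le_dist_of_mem hb.1)⟩
  have h1 := Metric.infDist_le_infDist_add_dist (s := A) (x := c a) (y := c t)
  rw [← hb.2, hc.dist_eq le_rfl (ht.1.trans ht.2) le_rfl, hc.dist_eq le_rfl ht.1 ht.2] at h1
  rw [hc.dist_eq ht.1 ht.2 le_rfl]
  linarith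

end ContractingGeometry

/-! ### Nearest point projections -/

section Nearest

variable {X : Type*} [MetricSpace X]

open Classical in
/-- A choice of a nearest point of `A`. -/
noncomputable def nearest (A : Set X) (x : X) : X :=
  if h : (proj A x).Nonempty then h.some else x

/-- The distance of the projections of two points to `A`. -/
noncomputable def projDist (A : Set X) (x y : X) : ℝ := dist (nearest A x) (nearest A y)

variable {A : Set X} {C : ℝ}

lemma nearest_mem_proj [ProperSpace X] (hcl : IsClosed A) (hne : A.Nonempty) (x : X) :
    nearest A x ∈ proj A x := by
  have h : (proj A x).Nonempty := exists_mem_proj hcl hne x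
  rw [nearest, dif_pos h]
  exact h.some_mem

lemma projDist_self (x : X) : projDist A x x = 0 := dist_self _

lemma projDist_comm (x y : X) : projDist A x y = projDist A y x := dist_comm _ _

lemma projDist_triangle (x y z : X) : projDist A x z ≤ projDist A x y + projDist A y z :=
  dist_triangle _ _ _

end Nearest

/-! ### Axes of contracting elements -/

section Axis

variable {G X : Type*} [Group G] [MetricSpace X] [MulAction G X]

/-- `γ` is a path on which `f` acts as the translation by `τ`, a quasi-geodesic whose range is
contracting. -/
structure IsAxis (f : G) (γ : ℝ → X) (τ l C : ℝ) : Prop where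
  tau_pos : 0 < τ
  one_le : 1 ≤ l
  pos : 0 < C
  equivariant : ∀ t, γ (t + τ) = f • γ t
  dist_le : ∀ s t, dist (γ s) (γ t) ≤ |s - t|
  length_le : ∀ s t, |s - t| ≤ l * dist (γ s) (γ t) + l
  isContracting : IsContracting C (range γ)

/-- The length of a subpath dominates the distance of its endpoints, so unit speed gives a
1-Lipschitz path. -/
lemma IsQuasiAxis.exists_isAxis {f : G} {γ : ℝ → X} (h : IsQuasiAxis f γ) :
    ∃ τ l C, IsAxis f γ τ l C := by
  obtain ⟨x, hx, ⟨l, hl⟩, C, hC, hA⟩ := h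
  refine ⟨_, l, C, hx.dist_pos, hl.one_le, hC, hx.equivariant, ?_,
    fun s t => hl.length_le s trivial t trivial, hA⟩
  have key : ∀ s t, s ≤ t → dist (γ s) (γ t) ≤ |s - t| := by
    intro s t hst
    have h1 := eVariationOn.edist_le γ (s := univ ∩ Icc s t) (x := s) (y := t) (by simp [hst])
      (by simp [hst])
    rw [hl.unitSpeed (mem_univ s) (mem_univ t), edist_dist] at h1
    have h2 := (ENNReal.ofReal_le_ofReal_iff (by simp [hst])).1 h1
    rw [abs_sub_comm, abs_of_nonneg (by linarith)]
    simpa using h2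
  intro s t
  rcases le_total s t with hst | hst
  · exact key s t hst
  · rw [dist_comm, abs_sub_comm]; exact key t s hst

lemma finite_setOf_dist_le [ProperSpace X] [ProperlyDiscontinuousSMul G X] (x : X) (R : ℝ) :
    {g : G | dist x (g • x) ≤ R}.Finite := by
  refine (ProperlyDiscontinuousSMul.finite_disjoint_inter_image (Γ := G)
    (isCompact_singleton (x := x)) (isCompact_closedBall x R)).subset fun g hg => ?_
  have : g • x ∈ (g • ·) '' {x} ∩ Metric.closedBall x R :=
    ⟨⟨x, rfl, rfl⟩, by rw [Metric.mem_closedBall, dist_comm]; exact hg⟩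
  exact Set.nonempty_of_mem this

/-- The elements that conjugate some nontrivial power of `f` to a nontrivial power of `f`. -/
def powerCommensurator (f : G) : Subgroup G where
  carrier := {g | ∃ a b : ℤ, a ≠ 0 ∧ b ≠ 0 ∧ g * f ^ b * g⁻¹ = f ^ a}
  one_mem' := ⟨1, 1, one_ne_zero, one_ne_zero, by simp⟩
  mul_mem' := by
    rintro g h ⟨a, b, ha, hb, hg⟩ ⟨c, d, hc, hd, hh⟩
    refine ⟨a * c, d * b, mul_ne_zero ha hc, mul_ne_zero hd hb, ?_⟩
    calc g * h * f ^ (d * b) * (g * h)⁻¹ = g * (h * f ^ d * h⁻¹) ^ b * g⁻¹ := by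
          rw [conj_zpow, ← zpow_mul]; group
      _ = (g * f ^ b * g⁻¹) ^ c := by
          rw [hh, conj_zpow, ← zpow_mul, ← zpow_mul, mul_comm c b]
      _ = f ^ (a * c) := by rw [hg, ← zpow_mul]
  inv_mem' := by
    rintro g ⟨a, b, ha, hb, hg⟩
    exact ⟨b, a, hb, ha, by rw [← hg]; group⟩

lemma zpow_mem_powerCommensurator (f : G) (n : ℤ) : f ^ n ∈ powerCommensurator f :=
  ⟨1, 1, one_ne_zero, one_ne_zero, by group⟩

namespace IsAxis

variable {f : G} {γ : ℝ → X} {τ l C : ℝ}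

lemma zpow_smul (h : IsAxis f γ τ l C) (n : ℤ) (t : ℝ) : f ^ n • γ t = γ (t + n * τ) := by
  induction n using Int.induction_on generalizing t with
  | zero => simp
  | succ n ih =>
    rw [zpow_add_one, mul_smul, ← h.equivariant, ih]; congr 1; push_cast; ring
  | pred n ih =>
    have h1 : f⁻¹ • γ t = γ (t - τ) := by
      rw [inv_smul_eq_iff, ← h.equivariant]; congr 1; ring
    rw [zpow_sub_one, mul_smul, h1, ih]; congr 1; push_cast; ring

lemma zpow_smul_mem_range (h : IsAxis f γ τ l C) (n : ℤ) {x : X} (hx : x ∈ range γ) :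
    f ^ n • x ∈ range γ := by
  obtain ⟨t, rfl⟩ := hx
  exact ⟨_, (h.zpow_smul n t).symm⟩

lemma nonempty_range (_ : IsAxis f γ τ l C) : (range γ).Nonempty := range_nonempty γ

/-- By the quasi-geodesic inequality, points of the axis near a given point have parameters in a
bounded interval, whose image is compact. -/
lemma isClosed_range (h : IsAxis f γ τ l C) : IsClosed (range γ) := by
  have hcont : Continuous γ := by
    have : LipschitzWith 1 γ := LipschitzWith.of_dist_le_mul fun s t => by
      simpa [Real.dist_eq] using h.dist_le s t
    exact this.continuous
  refine isClosed_of_closure_subset fun a ha => ?_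
  obtain ⟨_, ⟨s, rfl⟩, hs⟩ := Metric.mem_closure_iff.1 ha 1 one_pos
  have hcl : IsClosed (γ '' Icc (s - (2 * l + l)) (s + (2 * l + l))) :=
    (isCompact_Icc.image hcont).isClosed
  have : a ∈ closure (γ '' Icc (s - (2 * l + l)) (s + (2 * l + l))) := by
    rw [Metric.mem_closure_iff]
    intro ε hε
    obtain ⟨_, ⟨t, rfl⟩, ht⟩ := Metric.mem_closure_iff.1 ha (min ε 1) (by positivity)
    refine ⟨γ t, ⟨t, ?_, rfl⟩, ht.trans_le (min_le_left _ _)⟩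
    have h1 := ht.trans_le (min_le_right ε 1)
    have h2 := h.length_le t s
    have h3 := dist_triangle_left (γ t) (γ s) a
    have h4 : |t - s| ≤ 2 * l + l := by nlinarith [h.one_le]
    have := abs_le.1 h4
    exact ⟨by linarith [this.1], by linarith [this.2]⟩
  rw [hcl.closure_eq] at this
  exact image_subset_range _ _ this

lemma dist_zpow_smul (h : IsAxis f γ τ l C) (n : ℤ) {x : X} (hx : x ∈ range γ) :
    |(n : ℝ)| * τ ≤ l * dist x (f ^ n • x) + l := by
  obtain ⟨t, rfl⟩ := hx
  have := h.length_le t (t + n * τ)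
  rw [h.zpow_smul]
  rwa [show t - (t + n * τ) = -(n * τ) by ring, abs_neg, abs_mul, abs_of_pos h.tau_pos] at this

variable [ProperSpace X]

lemma nearest_mem_proj (h : IsAxis f γ τ l C) (x : X) :
    nearest (range γ) x ∈ proj (range γ) x :=
  DoubleCosetGrowth.nearest_mem_proj h.isClosed_range h.nonempty_range x

lemma nearest_mem (h : IsAxis f γ τ l C) (x : X) : nearest (range γ) x ∈ range γ :=
  (h.nearest_mem_proj x).1

lemma dist_nearest (h : IsAxis f γ τ l C) (x : X) :
    dist x (nearest (range γ) x) = Metric.infDist x (range γ) := (h.nearest_mem_proj x).2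

lemma dist_nearest_le (h : IsAxis f γ τ l C) (x : X) {a : X} (ha : a ∈ range γ) :
    dist x (nearest (range γ) x) ≤ dist x a := by
  rw [h.dist_nearest]; exact Metric.infDist_le_dist_of_mem ha

/-- The ⟨f⟩-orbit of `γ 0` occupies the parameters in τℤ; take the last one not after a nearest
point of `x`. -/
lemma exists_dist_zpow_le (h : IsAxis f γ τ l C) (x : X) :
    ∃ n : ℤ, dist x (f ^ n • γ 0) ≤ Metric.infDist x (range γ) + τ := by
  obtain ⟨t, ht⟩ := h.nearest_mem x
  refine ⟨⌊t / τ⌋, ?_⟩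
  rw [h.zpow_smul, ← h.dist_nearest, ← ht]
  refine (dist_triangle _ (γ t) _).trans (add_le_add le_rfl ((h.dist_le _ _).trans ?_))
  have h1 := Int.floor_le (t / τ)
  have h2 := (Int.lt_floor_add_one (t / τ)).le
  rw [le_div_iff₀ h.tau_pos] at h1
  rw [div_le_iff₀ h.tau_pos] at h2
  rw [abs_le]; constructor <;> linarith [h.tau_pos]

lemma dist_le_add (h : IsAxis f γ τ l C) (hX : IsGeodesicSpace X) {x y u v : X}
    (hu : u ∈ proj (range γ) x) (hv : v ∈ proj (range γ) y) : dist u v ≤ dist x y + 4 * C :=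
  h.isContracting.dist_proj_le h.isClosed_range h.nonempty_range h.pos.le hX hu hv

lemma projDist_le (h : IsAxis f γ τ l C) (hX : IsGeodesicSpace X) (x y : X) :
    projDist (range γ) x y ≤ dist x y + 4 * C :=
  h.dist_le_add hX (h.nearest_mem_proj x) (h.nearest_mem_proj y)

variable [IsIsometricSMul G X]

lemma zpow_smul_mem_proj (h : IsAxis f γ τ l C) (n : ℤ) {x u : X} (hu : u ∈ proj (range γ) x) :
    f ^ n • u ∈ proj (range γ) (f ^ n • x) := by
  refine ⟨h.zpow_smul_mem_range n hu.1, le_antisymm ?_ ?_⟩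
  · rw [← h.dist_nearest, dist_smul, hu.2, ← dist_smul (f ^ (-n)) (f ^ n • x)]
    rw [smul_smul, ← zpow_add, neg_add_cancel, zpow_zero, one_smul]
    exact Metric.infDist_le_dist_of_mem (h.zpow_smul_mem_range _ (h.nearest_mem _))
  · exact Metric.infDist_le_dist_of_mem (h.zpow_smul_mem_range n hu.1)

/-- The choice made in `nearest` need not be equivariant, but two nearest points of one point are at
most `4 * C` apart; this is lost at each end. -/
lemma projDist_zpow_smul_le (h : IsAxis f γ τ l C) (hX : IsGeodesicSpace X) (n : ℤ) (x y : X) :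
    projDist (range γ) (f ^ n • x) (f ^ n • y) ≤ projDist (range γ) x y + 8 * C := by
  have h1 := h.dist_le_add hX (h.nearest_mem_proj (f ^ n • x))
    (h.zpow_smul_mem_proj n (h.nearest_mem_proj x))
  have h2 := h.dist_le_add hX (h.zpow_smul_mem_proj n (h.nearest_mem_proj y))
    (h.nearest_mem_proj (f ^ n • y))
  have h3 := dist_triangle4 (nearest (range γ) (f ^ n • x)) (f ^ n • nearest (range γ) x)
    (f ^ n • nearest (range γ) y) (nearest (range γ) (f ^ n • y))
  rw [dist_self] at h1 h2
  rw [dist_smul] at h3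
  unfold projDist
  linarith

lemma le_projDist_zpow_smul (h : IsAxis f γ τ l C) (hX : IsGeodesicSpace X) (n : ℤ) (x : X) :
    |(n : ℝ)| * τ ≤ l * (projDist (range γ) x (f ^ n • x) + 4 * C) + l := by
  have h1 := h.dist_le_add hX (h.nearest_mem_proj (f ^ n • x))
    (h.zpow_smul_mem_proj n (h.nearest_mem_proj x))
  rw [dist_self] at h1
  refine (h.dist_zpow_smul n (h.nearest_mem x)).trans ?_
  have := dist_triangle (nearest (range γ) x) (nearest (range γ) (f ^ n • x))
    (f ^ n • nearest (range γ) x)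
  have hl := h.one_le
  unfold projDist
  gcongr
  linarith

lemma projDist_smul_le (h : IsAxis f γ τ l C) (hX : IsGeodesicSpace X) (g : G) (x y : X) :
    projDist (range γ) (g • x) (g • y) ≤ dist x y + 4 * C := by
  simpa only [dist_smul] using h.projDist_le hX (g • x) (g • y)

/-- A power of `f` translates all projections by a large distance. -/
lemma exists_le_projDist_zpow_smul (h : IsAxis f γ τ l C) (hX : IsGeodesicSpace X) (L : ℝ) :
    ∃ n : ℤ, ∀ x, L ≤ projDist (range γ) x (f ^ n • x) := by
  obtain ⟨n, hn⟩ := exists_nat_ge ((l * (L + 4 * C) + l) / τ)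
  refine ⟨n, fun x => ?_⟩
  have h1 := h.le_projDist_zpow_smul hX n x
  rw [div_le_iff₀ h.tau_pos] at hn
  have hl := h.one_le
  simp only [Int.cast_natCast, Nat.abs_cast] at h1
  have h2 : l * (L + 4 * C) ≤ l * (projDist (range γ) x (f ^ (n : ℤ) • x) + 4 * C) := by linarith
  linarith [le_of_mul_le_mul_left h2 (by linarith)]

variable [ProperlyDiscontinuousSMul G X]

/-- A translate of the axis whose projection to the axis is long is a translate by an element of
the commensurator, and it is close to the axis somewhere. -/
lemma exists_mem_of_lt_projDist (h : IsAxis f γ τ l C) (hX : IsGeodesicSpace X) :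
    ∃ θ : ℝ, 0 ≤ θ ∧ ∀ g : G,
      (∃ x ∈ range γ, ∃ y ∈ range γ, θ < projDist (range γ) (g • x) (g • y)) →
      g ∈ powerCommensurator f ∧
        ∃ i j : ℤ, dist (γ 0) ((f ^ (-i) * g * f ^ j) • γ 0) ≤ 2 * (5 * C + τ) := by
  have hC := h.pos
  have hτ := h.tau_pos
  set R := 5 * C + τ with hR
  have hRpos : 0 < R := by positivity
  have hfin := finite_setOf_dist_le (G := G) (γ 0) (2 * R)
  set M := hfin.toFinset.card with hM
  -- Room for `M + 1` sample points at spacing `2 * R + 1`, where `M` counts the elements that move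
  -- `γ 0` by at most `2 * R`; the two ends cost `4 * C`.
  refine ⟨M * (2 * R + 1) + 5 * C, by positivity, ?_⟩
  rintro g ⟨x, hx, y, hy, hxy⟩
  obtain ⟨c, h0, h1, hc⟩ := hX.exists_isGeodesicOn (g • x) (g • y)
  have hL0 : 0 ≤ dist (g • x) (g • y) := dist_nonneg
  generalize dist (g • x) (g • y) = L at *
  have hMR : 0 ≤ (M : ℝ) * (2 * R + 1) := by positivity
  obtain ⟨s, t, hs, hst, ht, hs', ht', hsu, htv⟩ := h.isContracting.exists_entry_exit
    h.isClosed_range h.nonempty_range hC.le hc hL0 (h.nearest_mem_proj _) (h.nearest_mem_proj _)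
    (by rw [h0, h1]; unfold projDist at hxy; linarith)
  rw [h0] at hsu
  rw [h1] at htv
  have hlen : M * (2 * R + 1) ≤ t - s := by
    have h2 := hc.dist_eq hs hst ht
    have h3 := dist_triangle4 (nearest (range γ) (g • x)) (c s) (c t) (nearest (range γ) (g • y))
    rw [dist_comm _ (c s)] at h3
    unfold projDist at hxy
    linarith
  have hz : ∀ m ∈ Finset.range (M + 1), s ≤ s + m * (2 * R + 1) ∧ s + m * (2 * R + 1) ≤ t := by
    intro m hm
    have : (m : ℝ) ≤ M := by exact_mod_cast Nat.lt_succ_iff.1 (Finset.mem_range.1 hm)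
    have h2 : (m : ℝ) * (2 * R + 1) ≤ M * (2 * R + 1) := by gcongr
    exact ⟨by have : 0 ≤ (m : ℝ) * (2 * R + 1) := by positivity
              linarith, by linarith⟩
  set z : ℕ → X := fun m => c (s + m * (2 * R + 1)) with hzdef
  have hi : ∀ m, ∃ i : ℤ, m ∈ Finset.range (M + 1) → dist (z m) (f ^ i • γ 0) ≤ R := by
    intro m
    obtain ⟨i, hi⟩ := h.exists_dist_zpow_le (z m)
    refine ⟨i, fun hm => hi.trans ?_⟩
    have := h.isContracting.infDist_le h.isClosed_range h.nonempty_range hC.le (hc.mono hs ht)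
      hs' ht' ⟨(hz m hm).1, (hz m hm).2⟩
    linarith
  have hj : ∀ m, ∃ j : ℤ, m ∈ Finset.range (M + 1) → dist (z m) ((g * f ^ j) • γ 0) ≤ R := by
    intro m
    obtain ⟨j, hj⟩ := h.exists_dist_zpow_le (g⁻¹ • z m)
    refine ⟨j, fun hm => ?_⟩
    have h2 := h.isContracting.infDist_le h.isClosed_range h.nonempty_range hC.le (hc.smul g⁻¹)
      (by rw [h0, inv_smul_smul, Metric.infDist_zero_of_mem hx]; exact hC.le)
      (by rw [h1, inv_smul_smul, Metric.infDist_zero_of_mem hy]; exact hC.le)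
      ⟨hs.trans (hz m hm).1, (hz m hm).2.trans ht⟩
    rw [← dist_smul g⁻¹ (z m), mul_smul, inv_smul_smul]
    refine hj.trans ?_
    have h3 : Metric.infDist (g⁻¹ • z m) (range γ) ≤ 5 * C := h2
    linarith
  choose i hi using hi
  choose j hj using hj
  have hS : ∀ m ∈ Finset.range (M + 1),
      dist (γ 0) ((f ^ (-i m) * g * f ^ j m) • γ 0) ≤ 2 * R := by
    intro m hm
    rw [← dist_smul (f ^ i m), smul_smul, ← mul_assoc, ← mul_assoc, ← zpow_add, add_neg_cancel,
      zpow_zero, one_mul]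
    have := dist_triangle_left (f ^ i m • γ 0) ((g * f ^ j m) • γ 0) (z m)
    linarith [hi m hm, hj m hm]
  refine ⟨?_, i 0, j 0, hS 0 (by simp)⟩
  -- Two samples give the same element `f ^ (-i) * g * f ^ j`. They are more than `2 * R` apart, so
  -- both exponents differ, and cancelling conjugates a nontrivial power of `f` to another.
  obtain ⟨m, hm, m', hm', hne, heq⟩ := Finset.exists_ne_map_eq_of_card_lt_of_maps_to
    (s := Finset.range (M + 1)) (t := hfin.toFinset) (f := fun m => f ^ (-i m) * g * f ^ j m)
    (by simp [hM]) (by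
      intro m hm
      simp only [Finite.coe_toFinset, mem_ofPred_eq]
      exact hS m hm)
  have hfar : 2 * R < dist (z m) (z m') := by
    rw [hzdef, hc _ ⟨hs.trans (hz m hm).1, (hz m hm).2.trans ht⟩ _
      ⟨hs.trans (hz m' hm').1, (hz m' hm').2.trans ht⟩]
    rw [show s + m * (2 * R + 1) - (s + m' * (2 * R + 1)) = ((m : ℝ) - m') * (2 * R + 1) by ring,
      abs_mul, abs_of_pos (show 0 < 2 * R + 1 by positivity)]
    have : (1 : ℝ) ≤ |(m : ℝ) - m'| := by
      have : (1 : ℤ) ≤ |(m : ℤ) - m'| := Int.one_le_abs (by omega)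
      exact_mod_cast this
    nlinarith
  have hine : i m ≠ i m' := by
    intro he
    have h2 := hi m hm
    have h3 := hi m' hm'
    rw [← he] at h3
    linarith [dist_triangle_right (z m) (z m') (f ^ i m • γ 0)]
  have hjne : j m ≠ j m' := by
    intro he
    have h2 := hj m hm
    have h3 := hj m' hm'
    rw [← he] at h3
    linarith [dist_triangle_right (z m) (z m') ((g * f ^ j m) • γ 0)]
  refine ⟨i m' - i m, j m' - j m, by omega, by omega, ?_⟩
  have h4 : g * f ^ j m' = f ^ i m' * (f ^ (-i m') * g * f ^ j m') := by group
  have h5 : g⁻¹ = f ^ j m * (f ^ (-i m) * g * f ^ j m)⁻¹ * f ^ (-i m) := by group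
  rw [zpow_sub, ← mul_assoc, h4, ← heq, h5, zpow_sub]
  group

end IsAxis

end Axis

/-! ### The system of projections to the translates of an axis -/

section ProjectionSystem

variable {G X : Type*} [Group G] [MetricSpace X] [MulAction G X]

/-- The properties of the pseudometric `d x y`, the distance of the projections of `x` and `y` to
an axis, and of its translates, that the counting of double cosets depends on. The translates of
the axis by `u` and by `v` are parallel if `u⁻¹ * v ∈ E`; the elements of `Z` preserve the axis. -/
structure IsProjectionSystem (E Z : Subgroup G) (d : X → X → ℝ) (o : X) (θ : ℝ) : Prop where
  le : Z ≤ E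
  ne_top : E ≠ ⊤
  self : ∀ x, d x x = 0
  comm : ∀ x y, d x y = d y x
  triangle : ∀ x y z, d x z ≤ d x y + d y z
  le_dist : ∀ x y, d x y ≤ dist x y + θ
  behrstock : ∀ v ∉ E, ∀ x, d x (v • o) ≤ θ ∨ d (v⁻¹ • x) (v⁻¹ • o) ≤ θ
  parallel : ∀ u ∉ E, ∀ e ∈ E, d (u • o) (u • e • o) ≤ θ
  finite : ∀ R : ℝ, {e : G | e ∈ E ∧ d o (e • o) ≤ R}.Finite
  exists_translation : ∀ L : ℝ, ∃ s ∈ Z, ∀ x, L ≤ d x (s • x)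
  smul_le : ∀ s ∈ Z, ∀ x y, d (s • x) (s • y) ≤ d x y + θ

end ProjectionSystem

/-! ### Behrstock's inequality, and the commensurator of an axis -/

namespace IsAxis

variable {G X : Type*} [Group G] [MetricSpace X] [MulAction G X]
variable {f : G} {γ : ℝ → X} {τ l C : ℝ} [ProperSpace X] [IsIsometricSMul G X]

/-- The inequality of Behrstock for the axis and a translate of it. -/
lemma projDist_le_or (h : IsAxis f γ τ l C) (hX : IsGeodesicSpace X) {θ : ℝ} {v : G}
    (hv : ∀ x ∈ range γ, ∀ y ∈ range γ, projDist (range γ) (v • x) (v • y) ≤ θ)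
    (hv' : ∀ x ∈ range γ, ∀ y ∈ range γ, projDist (range γ) (v⁻¹ • x) (v⁻¹ • y) ≤ θ) (o x : X) :
    projDist (range γ) x (v • o) ≤ θ + dist o (γ 0) + 9 * C ∨
      projDist (range γ) (v⁻¹ • x) (v⁻¹ • o) ≤ θ + dist o (γ 0) + 9 * C := by
  have hC := h.pos
  rw [or_iff_not_imp_left, not_le]
  intro hlt
  set a := nearest (range γ) (v⁻¹ • x) with ha
  -- The translate of the axis projects near `v • o`, so `x` and `v • a` have distant projections
  -- and a geodesic between them comes near the axis at some `c s`.
  have h1 : C < projDist (range γ) x (v • a) := by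
    have h2 := projDist_triangle (A := range γ) x (v • a) (v • o)
    have h3 := projDist_triangle (A := range γ) (v • a) (v • γ 0) (v • o)
    have h4 := hv a (h.nearest_mem _) (γ 0) (mem_range_self 0)
    have h5 := h.projDist_smul_le hX v (γ 0) o
    rw [dist_comm] at h5
    linarith
  obtain ⟨c, hc0, hc1, hc⟩ := hX.exists_isGeodesicOn x (v • a)
  have hL0 : 0 ≤ dist x (v • a) := dist_nonneg
  generalize dist x (v • a) = L at *
  obtain ⟨s, t, hs, hst, ht, hs', -, -, -⟩ := h.isContracting.exists_entry_exit h.isClosed_range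
    h.nonempty_range hC.le hc hL0 (h.nearest_mem_proj _) (h.nearest_mem_proj _)
    (by rw [hc0, hc1]; exact h1)
  have hcL : v⁻¹ • c L = a := by rw [hc1, inv_smul_smul]
  -- The points `x` and `c s` share the nearest point `v • a` of the translate. As `c s` is near the
  -- axis, that point lies near the bounded projection of the axis to the translate.
  have h2 : a ∈ proj (range γ) (v⁻¹ • c s) := by
    have := mem_proj_of_isGeodesicOn (A := range γ) (hc.smul v⁻¹) ⟨hs, hst.trans ht⟩
      (by simp only [hcL, hc0]; exact h.nearest_mem_proj _)
    simpa only [hcL] using this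
  have h3 := h.dist_le_add hX h2 (h.nearest_mem_proj (v⁻¹ • nearest (range γ) (c s)))
  rw [dist_smul, h.dist_nearest] at h3
  have h4 := hv' _ (h.nearest_mem (c s)) (γ 0) (mem_range_self 0)
  have h5 := h.projDist_smul_le hX v⁻¹ (γ 0) o
  rw [dist_comm] at h5
  have h6 := projDist_triangle (A := range γ) (v⁻¹ • nearest (range γ) (c s)) (v⁻¹ • γ 0) (v⁻¹ • o)
  have h7 := dist_triangle a (nearest (range γ) (v⁻¹ • nearest (range γ) (c s)))
    (nearest (range γ) (v⁻¹ • o))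
  unfold projDist at *
  linarith

variable [ProperlyDiscontinuousSMul G X]

lemma exists_projDist_le (h : IsAxis f γ τ l C) (hX : IsGeodesicSpace X) :
    ∃ θ : ℝ, 0 ≤ θ ∧ ∀ g ∉ powerCommensurator f, ∀ x ∈ range γ, ∀ y ∈ range γ,
      projDist (range γ) (g • x) (g • y) ≤ θ := by
  obtain ⟨θ, h0, hθ⟩ := h.exists_mem_of_lt_projDist hX
  refine ⟨θ, h0, fun g hg x hx y hy => ?_⟩
  by_contra! hlt
  exact hg (hθ g ⟨x, hx, y, hy, hlt⟩).1

/-- The subgroup generated by `f` has finite index in the commensurator. -/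
lemma exists_finite_cosets (h : IsAxis f γ τ l C) (hX : IsGeodesicSpace X) :
    ∃ T : Set G, T.Finite ∧ ∀ e ∈ powerCommensurator f, ∃ m : ℤ, ∃ c ∈ T, e = f ^ m * c := by
  obtain ⟨θ, h0, hθ⟩ := h.exists_mem_of_lt_projDist hX
  set S := {s : G | dist (γ 0) (s • γ 0) ≤ 2 * (5 * C + τ)}
  have hS : S.Finite := finite_setOf_dist_le _ _
  have hSE : ∀ s : G, ∃ a b : ℤ, s ∈ powerCommensurator f → b ≠ 0 ∧ s * f ^ b * s⁻¹ = f ^ a := by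
    intro s
    by_cases hs : s ∈ powerCommensurator f
    · obtain ⟨a, b, -, hb, hab⟩ := hs
      exact ⟨a, b, fun _ => ⟨hb, hab⟩⟩
    · exact ⟨0, 0, fun h => absurd h hs⟩
  choose a b hab using hSE
  -- Since `s * f ^ b s * s⁻¹ = f ^ a s`, powers of `f` move from the right of `s` to the left in
  -- multiples of `b s`; only a remainder below `|b s|` stays.
  refine ⟨⋃ s ∈ S, (fun r : ℤ => s * f ^ r) '' Ico 0 |b s|,
    hS.biUnion fun s _ => (finite_Ico _ _).image _, fun e he => ?_⟩
  obtain ⟨i, j, hij⟩ : ∃ i j : ℤ, f ^ (-i) * e * f ^ j ∈ S := by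
    refine (hθ e ?_).2
    -- `e` sends `f ^ (q * k) • γ 0` within `κ` of `f ^ (p * k) • γ 0`, so for large `k` the
    -- translate by `e` has a long projection.
    obtain ⟨p, q, hp, -, hpq⟩ := he
    set κ := dist (e • γ 0) (γ 0) with hκ
    have hκ0 : 0 ≤ κ := dist_nonneg
    obtain ⟨k, hk⟩ := exists_nat_ge ((l * (θ + 4 * κ + 1) + l) / τ)
    rw [div_le_iff₀ h.tau_pos] at hk
    refine ⟨γ 0, ⟨0, rfl⟩, f ^ (q * k) • γ 0, h.zpow_smul_mem_range _ ⟨0, rfl⟩, ?_⟩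
    have h1 : e • f ^ (q * k) • γ 0 = f ^ (p * k) • e • γ 0 := by
      have : f ^ (p * k) = e * f ^ (q * k) * e⁻¹ := by
        rw [zpow_mul, ← hpq, conj_zpow, ← zpow_mul]
      rw [this, smul_smul, smul_smul]; congr 1; group
    have h2 : dist (e • f ^ (q * k) • γ 0) (f ^ (p * k) • γ 0) = κ := by rw [h1, dist_smul]
    have h3 := h.dist_nearest_le (e • f ^ (q * k) • γ 0)
      (h.zpow_smul_mem_range (p * k) (mem_range_self 0))
    have h4 := h.dist_nearest_le (e • γ 0) (mem_range_self 0)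
    have h5 := h.dist_zpow_smul (p * k) (mem_range_self 0)
    have h6 : (k : ℝ) * τ ≤ |((p * k : ℤ) : ℝ)| * τ := by
      have : (1 : ℝ) ≤ |(p : ℝ)| := by exact_mod_cast Int.one_le_abs hp
      push_cast
      rw [abs_mul, Nat.abs_cast]
      have h7 := h.tau_pos
      gcongr
      nlinarith [Nat.cast_nonneg (α := ℝ) k]
    have h8 : θ + 4 * κ + 1 ≤ dist (γ 0) (f ^ (p * k) • γ 0) := by
      have h9 : l * (θ + 4 * κ + 1) ≤ l * dist (γ 0) (f ^ (p * k) • γ 0) := by linarith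
      exact le_of_mul_le_mul_left h9 (by linarith [h.one_le])
    have h10 := dist_triangle4 (γ 0) (nearest (range γ) (e • γ 0))
      (nearest (range γ) (e • f ^ (q * k) • γ 0)) (f ^ (p * k) • γ 0)
    have h11 := dist_triangle_left (γ 0) (nearest (range γ) (e • γ 0)) (e • γ 0)
    have h12 := dist_triangle_left (nearest (range γ) (e • f ^ (q * k) • γ 0)) (f ^ (p * k) • γ 0)
      (e • f ^ (q * k) • γ 0)
    unfold projDist
    linarith
  set s := f ^ (-i) * e * f ^ j with hs
  have hsE : s ∈ powerCommensurator f := mul_mem (mul_mem (zpow_mem_powerCommensurator _ _) he)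
    (zpow_mem_powerCommensurator _ _)
  obtain ⟨hb, hsab⟩ := hab s hsE
  refine ⟨i + a s * (-j / b s), s * f ^ (-j % b s), ?_, ?_⟩
  · exact mem_biUnion hij ⟨-j % b s, ⟨Int.emod_nonneg _ hb, Int.emod_lt_abs _ hb⟩, rfl⟩
  · have h1 : e = f ^ i * (s * f ^ (-j)) := by rw [hs]; group
    have h2 : f ^ (a s * (-j / b s)) = s * f ^ (b s * (-j / b s)) * s⁻¹ := by
      rw [zpow_mul, ← hsab, conj_zpow, ← zpow_mul]
    rw [zpow_add, h2, h1]
    conv_lhs => rw [← Int.mul_ediv_add_emod (-j) (b s), zpow_add]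
    group

/-- Otherwise ⟨f⟩ would be a cyclic subgroup of finite index; inversion converts right coset
representatives to left ones. -/
lemma powerCommensurator_ne_top (h : IsAxis f γ τ l C) (hX : IsGeodesicSpace X)
    (hG : IsNonElementary G) : powerCommensurator f ≠ ⊤ := by
  intro htop
  obtain ⟨T, hT, hcov⟩ := h.exists_finite_cosets hX
  refine hG ⟨Subgroup.zpowers f, inferInstance, ?_⟩
  have : Finite (G ⧸ Subgroup.zpowers f) := by
    have := hT.to_subtype
    refine Finite.of_surjective
      (fun c : T => (QuotientGroup.mk (c : G)⁻¹ : G ⧸ Subgroup.zpowers f)) fun q => ?_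
    obtain ⟨g, rfl⟩ := QuotientGroup.mk_surjective q
    obtain ⟨m, c, hc, hm⟩ := hcov g⁻¹ (htop ▸ Subgroup.mem_top _)
    refine ⟨⟨c, hc⟩, QuotientGroup.eq.2 ?_⟩
    rw [inv_inv, show g = c⁻¹ * f ^ (-m) by rw [← inv_inv g, hm]; group, mul_inv_cancel_left]
    exact Subgroup.zpow_mem_zpowers f _
  exact Subgroup.finiteIndex_of_finite_quotient

/-- One `θ` absorbs all errors. Behrstock and parallelism rest on the bounded projections of
translates outside the commensurator, finiteness on the linear growth in `m` of the displacement of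
projections by `f ^ m`. -/
theorem exists_isProjectionSystem (h : IsAxis f γ τ l C) (hX : IsGeodesicSpace X)
    (hG : IsNonElementary G) (o : X) :
    ∃ θ, IsProjectionSystem (powerCommensurator f) (Subgroup.zpowers f) (projDist (range γ)) o
      θ := by
  obtain ⟨θ, hθ0, hθ⟩ := h.exists_projDist_le hX
  obtain ⟨T, hT, hcov⟩ := h.exists_finite_cosets hX
  have hC := h.pos
  obtain ⟨κ, hκ⟩ : ∃ κ : ℝ, ∀ c ∈ T, dist (c • o) o ≤ κ := by
    obtain ⟨κ, hκ⟩ := (hT.image fun c => dist (c • o) o).bddAbove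
    exact ⟨κ, fun c hc => hκ ⟨c, hc, rfl⟩⟩
  have hκ' : ∀ c ∈ T, dist (c • o) o ≤ |κ| := fun c hc => (hκ c hc).trans (le_abs_self κ)
  have hκ0 := abs_nonneg κ
  have hd0 : 0 ≤ dist o (γ 0) := dist_nonneg
  have hpar : ∀ u ∉ powerCommensurator f, ∀ e ∈ powerCommensurator f,
      projDist (range γ) (u • o) (u • e • o) ≤ θ + 2 * dist o (γ 0) + |κ| + 8 * C := by
    intro u hu e he
    obtain ⟨m, c, hc, rfl⟩ := hcov e he
    have h1 := h.projDist_smul_le hX u o (γ 0)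
    have h2 := hθ u hu (γ 0) (mem_range_self 0) (f ^ m • γ 0)
      (h.zpow_smul_mem_range m (mem_range_self 0))
    have h3 := h.projDist_smul_le hX u (f ^ m • γ 0) ((f ^ m * c) • o)
    rw [mul_smul, dist_smul] at h3
    have h4 := dist_triangle (γ 0) o (c • o)
    have h5 := hκ' c hc
    rw [dist_comm (γ 0) o, dist_comm o (c • o)] at h4
    have h6 := projDist_triangle (A := range γ) (u • o) (u • γ 0) (u • f ^ m • c • o)
    have h7 := projDist_triangle (A := range γ) (u • γ 0) (u • f ^ m • γ 0) (u • f ^ m • c • o)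
    rw [mul_smul]
    linarith
  refine ⟨θ + 2 * dist o (γ 0) + |κ| + 9 * C, ?_, h.powerCommensurator_ne_top hX hG, projDist_self,
    projDist_comm, projDist_triangle, ?_, ?_, ?_, ?_, ?_, ?_⟩
  · rintro _ ⟨n, rfl⟩
    exact zpow_mem_powerCommensurator f n
  · intro x y
    linarith [h.projDist_le hX x y]
  · intro v hv x
    refine (h.projDist_le_or hX (hθ v hv) (hθ v⁻¹ fun hv' => hv ?_) o x).imp ?_ ?_
    · simpa using inv_mem hv'
    · intro h1; linarith
    · intro h1; linarith
  · intro u hu e he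
    linarith [hpar u hu e he]
  · intro R
    obtain ⟨N, hN⟩ := exists_nat_ge ((l * ((R + |κ| + 4 * C) + 4 * C) + l) / τ)
    rw [div_le_iff₀ h.tau_pos] at hN
    refine (((finite_Icc (-(N : ℤ)) N).prod hT).image fun p => f ^ p.1 * p.2).subset ?_
    rintro e ⟨he, heR⟩
    obtain ⟨m, c, hc, rfl⟩ := hcov e he
    refine ⟨(m, c), ⟨?_, hc⟩, rfl⟩
    have h1 := h.le_projDist_zpow_smul hX m o
    have h2 := h.projDist_smul_le hX (f ^ m) (c • o) o
    have h3 := projDist_triangle (A := range γ) o ((f ^ m * c) • o) (f ^ m • o)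
    rw [mul_smul] at h3 heR
    have h4 : projDist (range γ) o (f ^ m • o) ≤ R + |κ| + 4 * C := by linarith [hκ' c hc]
    have h5 : l * (projDist (range γ) o (f ^ m • o) + 4 * C) ≤ l * ((R + |κ| + 4 * C) + 4 * C) := by
      have := h.one_le
      gcongr
    have h6 : |(m : ℝ)| ≤ N := le_of_mul_le_mul_right (by linarith) h.tau_pos
    have h7 : |m| ≤ (N : ℤ) := by exact_mod_cast h6
    exact abs_le.1 h7
  · intro L
    obtain ⟨n, hn⟩ := h.exists_le_projDist_zpow_smul hX L
    exact ⟨f ^ n, Subgroup.zpow_mem_zpowers f n, hn⟩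
  · rintro _ ⟨n, rfl⟩ x y
    have := h.projDist_zpow_smul_le hX n x y
    simp only
    linarith

end IsAxis

/-! ### Counting double cosets with a projection system -/

section Counting

variable {G X : Type*} [Group G] [MetricSpace X] [MulAction G X]

namespace IsProjectionSystem

variable {E Z : Subgroup G} {d : X → X → ℝ} {o : X} {θ : ℝ}

lemma nonneg (P : IsProjectionSystem E Z d o θ) (x y : X) : 0 ≤ d x y := by
  have := P.triangle x y x
  rw [P.self, P.comm y x] at this
  linarith

lemma exists_notMem (P : IsProjectionSystem E Z d o θ) : ∃ u, u ∉ E := by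
  by_contra! h
  exact P.ne_top ((Subgroup.eq_top_iff' E).2 h)

lemma theta_nonneg (P : IsProjectionSystem E Z d o θ) : 0 ≤ θ := by
  obtain ⟨u, hu⟩ := P.exists_notMem
  exact (P.nonneg _ _).trans (P.parallel u hu 1 (one_mem E))

/-- The axes `v⁻¹ * s⁻¹`, `1`, `s * m` and `s * m * s⁻¹ * v'⁻¹ * s⁻¹` form a chain, so that the
quadrilateral cannot close up. -/
lemma not_closed_chain (P : IsProjectionSystem E Z d o θ) {s v v' m n : G} {c L : ℝ} (hs : s ∈ Z)
    (hL : ∀ x, L ≤ d x (s • x)) (hcL : 2 * c + 6 * θ < L) (hv : v ∉ E) (hv' : v' ∉ E)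
    (hvc : d o (v⁻¹ • o) ≤ c) (hvc' : d o (v' • o) ≤ c) (hvi' : d o (v'⁻¹ • o) ≤ c)
    (hmc : d o (m • o) ≤ c) (hmi : d o (m⁻¹ • o) ≤ c) (hnc : d o (n • o) ≤ c)
    (hn : n = s * v' * s * m⁻¹ * s⁻¹ * v⁻¹ * s⁻¹) : m ∈ E := by
  by_contra hm
  have hθ := P.theta_nonneg
  have hsE := P.le hs
  have hsi : s⁻¹ ∈ Z := inv_mem hs
  have hsiE := P.le hsi
  have hL' : ∀ x, L ≤ d x (s⁻¹ • x) := fun x => by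
    simpa [P.comm] using hL (s⁻¹ • x)
  have hv1 : v⁻¹ ∉ E := fun h => hv (by simpa using inv_mem h)
  have hv1' : v'⁻¹ ∉ E := fun h => hv' (by simpa using inv_mem h)
  have hm1 : m⁻¹ ∉ E := fun h => hm (by simpa using inv_mem h)
  -- On the base axis the first point projects near `o` and the second near `s • o`; Behrstock then
  -- carries the separation to the next axis.
  have h1 : θ < d (v⁻¹ • s⁻¹ • o) (s • m • o) := by
    have e1 := P.parallel v⁻¹ hv1 s⁻¹ hsiE
    have e2 := P.smul_le s hs o (m • o)
    have e3 := P.triangle o (v⁻¹ • o) (s • o)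
    have e4 := P.triangle (v⁻¹ • o) (v⁻¹ • s⁻¹ • o) (s • o)
    have e5 := P.triangle (v⁻¹ • s⁻¹ • o) (s • m • o) (s • o)
    rw [P.comm (s • m • o)] at e5
    linarith [hL o]
  have h2 : d (m⁻¹ • s⁻¹ • v⁻¹ • s⁻¹ • o) (m⁻¹ • s⁻¹ • o) ≤ θ := by
    have hsm : s * m ∉ E := fun h => hm ((mul_mem_cancel_left hsE).1 h)
    have := (P.behrstock (s * m) hsm (v⁻¹ • s⁻¹ • o)).resolve_left
      (by rw [mul_smul]; exact not_le.2 h1)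
    simpa only [mul_inv_rev, mul_smul] using this
  -- The longest comparison of the chain: it is the one that uses all of `2 * c + 6 * θ`.
  have h3 : θ < d (m⁻¹ • s⁻¹ • v⁻¹ • s⁻¹ • o) (s⁻¹ • v'⁻¹ • s⁻¹ • o) := by
    have e1 := P.parallel m⁻¹ hm1 s⁻¹ hsiE
    have e2 := P.smul_le s⁻¹ hsi o (v'⁻¹ • o)
    have e3 := P.smul_le s⁻¹ hsi (v'⁻¹ • o) (v'⁻¹ • s⁻¹ • o)
    have e4 := P.parallel v'⁻¹ hv1' s⁻¹ hsiE
    have e5 := P.triangle o (m⁻¹ • o) (s⁻¹ • o)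
    have e6 := P.triangle (m⁻¹ • o) (m⁻¹ • s⁻¹ • o) (s⁻¹ • o)
    have e7 := P.triangle (m⁻¹ • s⁻¹ • o) (m⁻¹ • s⁻¹ • v⁻¹ • s⁻¹ • o) (s⁻¹ • o)
    have e8 := P.triangle (m⁻¹ • s⁻¹ • v⁻¹ • s⁻¹ • o) (s⁻¹ • v'⁻¹ • s⁻¹ • o) (s⁻¹ • o)
    have e9 := P.triangle (s⁻¹ • v'⁻¹ • s⁻¹ • o) (s⁻¹ • v'⁻¹ • o) (s⁻¹ • o)
    rw [P.comm] at h2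
    rw [P.comm (s⁻¹ • v'⁻¹ • s⁻¹ • o) (s⁻¹ • v'⁻¹ • o), P.comm (s⁻¹ • v'⁻¹ • o) (s⁻¹ • o)] at e9
    linarith [hL' o]
  have h4 : d (n • o) (s • v' • s • o) ≤ θ := by
    have hsv : s⁻¹ * v'⁻¹ * s⁻¹ ∉ E := fun h =>
      hv1' ((mul_mem_cancel_left hsiE).1 ((mul_mem_cancel_right hsiE).1 h))
    have := (P.behrstock _ hsv (m⁻¹ • s⁻¹ • v⁻¹ • s⁻¹ • o)).resolve_left
      (by simp only [mul_smul]; exact not_le.2 h3)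
    rw [hn]
    simpa only [mul_inv_rev, inv_inv, mul_smul] using this
  -- By `h4` the projection of `n • o` is near that of `s • o`, although `n` moves the projection of
  -- `o` by at most `c`.
  have e1 := P.parallel v' hv' s hsE
  have e2 := P.smul_le s hs (v' • o) (v' • s • o)
  have e3 := P.smul_le s hs o (v' • o)
  have e4 := P.triangle o (n • o) (s • o)
  have e5 := P.triangle (n • o) (s • v' • s • o) (s • o)
  have e6 := P.triangle (s • v' • s • o) (s • v' • o) (s • o)
  rw [P.comm (s • v' • s • o) (s • v' • o), P.comm (s • v' • o) (s • o)] at e6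
  linarith [hL o]

/-- One of the projections of a point to two axes that are not parallel is bounded. -/
lemma le_or_le (P : IsProjectionSystem E Z d o θ) {p q : G} (hpq : p⁻¹ * q ∉ E) :
    ∃ D : ℝ, ∀ x, d (p⁻¹ • o) (p⁻¹ • x) ≤ D ∨ d (q⁻¹ • o) (q⁻¹ • x) ≤ D := by
  have h1 := P.nonneg (p⁻¹ • o) (p⁻¹ • q • o)
  have h2 := P.nonneg (q⁻¹ • o) (q⁻¹ • p • o)
  refine ⟨θ + d (p⁻¹ • o) (p⁻¹ • q • o) + d (q⁻¹ • o) (q⁻¹ • p • o), fun x => ?_⟩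
  refine (P.behrstock _ hpq (p⁻¹ • x)).imp (fun h => ?_) fun h => ?_
  · have h3 := P.triangle (p⁻¹ • o) (p⁻¹ • q • o) (p⁻¹ • x)
    rw [mul_smul, P.comm] at h
    linarith
  · have h3 := P.triangle (q⁻¹ • o) (q⁻¹ • p • o) (q⁻¹ • x)
    simp only [mul_inv_rev, inv_inv, mul_smul, smul_inv_smul] at h
    rw [P.comm] at h
    linarith

variable [IsIsometricSMul G X]

/-- Replacing `o` by its image under `p⁻¹` or `q` changes projections by at most the displacement of
`o` plus `θ`. -/
lemma le_conj (P : IsProjectionSystem E Z d o θ) {p q g : G} {D : ℝ}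
    (h : d (p⁻¹ • o) (p⁻¹ • g • o) ≤ D) :
    d o ((p⁻¹ * g * q) • o) ≤ dist o (p • o) + dist o (q • o) + 2 * θ + D := by
  have h1 := P.le_dist o (p⁻¹ • o)
  have h2 := P.le_dist (p⁻¹ • g • o) (p⁻¹ • g • q • o)
  have h3 := P.triangle o (p⁻¹ • o) ((p⁻¹ * g * q) • o)
  have h4 := P.triangle (p⁻¹ • o) (p⁻¹ • g • o) ((p⁻¹ * g * q) • o)
  rw [← dist_smul p, smul_inv_smul, dist_comm] at h1
  rw [dist_smul, dist_smul] at h2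
  simp only [mul_smul] at h3 h4 ⊢
  linarith

/-- A subgroup with bounded projection to an axis has finite intersection with its stabilizer. -/
lemma finite_conj_mem (P : IsProjectionSystem E Z d o θ) {p : G} {D : ℝ} :
    {h : G | p⁻¹ * h * p ∈ E ∧ d (p⁻¹ • o) (p⁻¹ • h • o) ≤ D}.Finite := by
  refine ((P.finite (dist o (p • o) + dist o (p • o) + 2 * θ + D)).image
    fun e => p * e * p⁻¹).subset ?_
  rintro h ⟨hE, hD⟩
  exact ⟨p⁻¹ * h * p, ⟨hE, P.le_conj hD⟩, by group⟩

/-- If a subgroup has a bounded projection to an axis, then it has bounded projections to two axes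
that are not parallel. -/
lemma exists_pair (P : IsProjectionSystem E Z d o θ) {H : Subgroup G}
    (hH : ∃ (p : G) (D : ℝ), ∀ h ∈ H, d (p⁻¹ • o) (p⁻¹ • h • o) ≤ D) :
    ∃ (p q : G) (D : ℝ), p⁻¹ * q ∉ E ∧ (∀ h ∈ H, d (p⁻¹ • o) (p⁻¹ • h • o) ≤ D) ∧
      ∀ h ∈ H, d (q⁻¹ • o) (q⁻¹ • h • o) ≤ D := by
  obtain ⟨p, D, hD⟩ := hH
  have hD0 : 0 ≤ D := (P.nonneg _ _).trans (hD 1 (one_mem H))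
  -- If so, `H` is finite and any two axes serve. If not, some `k ∈ H` moves the axis to a
  -- non-parallel one, and the projection of `h • o` to it is that of `(k⁻¹ * h) • o` to the old
  -- one.
  by_cases hE : ∀ h ∈ H, p⁻¹ * h * p ∈ E
  · have hfin : (H : Set G).Finite :=
      (P.finite_conj_mem (p := p) (D := D)).subset fun h hh => ⟨hE h hh, hD h hh⟩
    obtain ⟨u, hu⟩ := P.exists_notMem
    obtain ⟨D', hD'⟩ := (hfin.image fun h => d (u⁻¹ • o) (u⁻¹ • h • o)).bddAbove
    obtain ⟨D'', hD''⟩ := (hfin.image fun h => d ((1 : G)⁻¹ • o) ((1 : G)⁻¹ • h • o)).bddAbove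
    exact ⟨1, u, max D' D'', by simpa using hu,
      fun h hh => (hD'' ⟨h, hh, rfl⟩).trans (le_max_right _ _),
      fun h hh => (hD' ⟨h, hh, rfl⟩).trans (le_max_left _ _)⟩
  · push Not at hE
    obtain ⟨k, hk, hkE⟩ := hE
    refine ⟨p, k * p, D + D, by rwa [← mul_assoc], fun h hh => (hD h hh).trans (by linarith),
      fun h hh => ?_⟩
    have h1 := hD _ (inv_mem hk)
    have h2 := hD _ (mul_mem (inv_mem hk) hh)
    rw [P.comm] at h1
    simp only [mul_inv_rev, mul_smul] at h2 ⊢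
    exact (P.triangle _ (p⁻¹ • o) _).trans (add_le_add h1 h2)

end IsProjectionSystem

lemma finite_doubleCosets [ProperSpace X] [ProperlyDiscontinuousSMul G X] (H K : Subgroup G) (o : X)
    (r : ℝ) : {D : Set G | (∃ g : G, D = DoubleCoset.doubleCoset g (H : Set G) (K : Set G)) ∧
      ∃ x ∈ D, dist o (x • o) < r}.Finite := by
  refine ((finite_setOf_dist_le (G := G) o r).image
    fun x => DoubleCoset.doubleCoset x (H : Set G) (K : Set G)).subset ?_
  rintro _ ⟨⟨g, rfl⟩, x, hx, hr⟩
  exact ⟨x, hr.le, DoubleCoset.doubleCoset_eq_of_mem hx⟩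

lemma doubleCosetGrowth_pos [ProperSpace X] [ProperlyDiscontinuousSMul G X] (H K : Subgroup G)
    (o : X) {r : ℝ} (hr : 0 < r) : 0 < doubleCosetGrowth H K o r := by
  refine (Set.ncard_pos (finite_doubleCosets H K o r)).2
    ⟨DoubleCoset.doubleCoset 1 (H : Set G) (K : Set G), ⟨1, rfl⟩, 1,
      DoubleCoset.mem_doubleCoset_self _ _ _, by simpa⟩

/-- The number of elements of `T` is bounded by the number of double cosets, up to a multiplicative
constant and a shift of the radius. -/
def IsControlled (H K : Subgroup G) (o : X) (T : Set G) : Prop :=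
  ∃ (r₀ : ℝ) (N : ℕ), ∀ r : ℝ, 0 < r →
    {g : G | g ∈ T ∧ dist o (g • o) ≤ r - r₀}.ncard ≤ N * doubleCosetGrowth H K o r

/-! ### Combining controlled sets -/

namespace IsControlled

variable [ProperSpace X] [ProperlyDiscontinuousSMul G X] {H K : Subgroup G} {o : X} {S T : Set G}

lemma finite_ball (o : X) (T : Set G) (R : ℝ) : {g : G | g ∈ T ∧ dist o (g • o) ≤ R}.Finite :=
  (finite_setOf_dist_le o R).subset fun _ h => h.2

lemma of_finite (hT : T.Finite) : IsControlled H K o T := by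
  refine ⟨0, T.ncard, fun r hr => ?_⟩
  calc _ ≤ T.ncard := Set.ncard_le_ncard (fun _ h => h.1) hT
    _ ≤ T.ncard * doubleCosetGrowth H K o r :=
      Nat.le_mul_of_pos_right _ (doubleCosetGrowth_pos H K o hr)

lemma union (hS : IsControlled H K o S) (hT : IsControlled H K o T) :
    IsControlled H K o (S ∪ T) := by
  obtain ⟨r, M, hS⟩ := hS
  obtain ⟨s, N, hT⟩ := hT
  refine ⟨max r s, M + N, fun t ht => ?_⟩
  calc _ ≤ ({g : G | g ∈ S ∧ dist o (g • o) ≤ t - r} ∪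
        {g : G | g ∈ T ∧ dist o (g • o) ≤ t - s}).ncard := by
        refine Set.ncard_le_ncard ?_ ((finite_ball o S _).union (finite_ball o T _))
        rintro g ⟨hg | hg, hgt⟩
        · exact Or.inl ⟨hg, hgt.trans (by linarith [le_max_left r s])⟩
        · exact Or.inr ⟨hg, hgt.trans (by linarith [le_max_right r s])⟩
    _ ≤ _ := Set.ncard_union_le _ _
    _ ≤ (M + N) * doubleCosetGrowth H K o t := by
        rw [add_mul]; exact add_le_add (hS t ht) (hT t ht)

lemma mono (hT : IsControlled H K o T) (h : S ⊆ T) : IsControlled H K o S := by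
  obtain ⟨r, N, hT⟩ := hT
  exact ⟨r, N, fun t ht => (Set.ncard_le_ncard (fun _ hg => And.intro (h hg.1) hg.2)
    (finite_ball o T _)).trans (hT t ht)⟩

/-- Count fibres of `g ↦ H a g b K`. Multiplying by `a` and `b` costs their displacements of `o`;
the further 1 in the shift yields the strict inequality in the double coset count. -/
lemma of_fibers [IsIsometricSMul G X] (a b : G) {N : ℕ}
    (h : ∀ g ∈ T, ∃ F : Set G, F.Finite ∧ F.ncard ≤ N ∧ ∀ g' ∈ T,
      (∃ h ∈ H, ∃ k ∈ K, a * g' * b = h * (a * g * b) * k) → g' ∈ F) :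
    IsControlled H K o T := by
  classical
  refine ⟨dist o (a • o) + dist o (b • o) + 1, N, fun r hr => ?_⟩
  have hfin := finite_ball o T (r - (dist o (a • o) + dist o (b • o) + 1))
  have hfin' := finite_doubleCosets H K o r
  rw [Set.ncard_eq_toFinset_card _ hfin, doubleCosetGrowth, Set.ncard_eq_toFinset_card _ hfin']
  refine Finset.card_le_mul_card_image_of_maps_to
    (f := fun g => DoubleCoset.doubleCoset (a * g * b) (H : Set G) (K : Set G)) ?_ N ?_
  · intro g hg
    rw [Set.Finite.mem_toFinset] at hg ⊢
    refine ⟨⟨_, rfl⟩, a * g * b, DoubleCoset.mem_doubleCoset_self _ _ _, ?_⟩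
    have h1 := dist_triangle4 o (a • o) (a • g • o) (a • g • b • o)
    have h2 := hg.2
    simp only [dist_smul] at h1
    rw [mul_smul, mul_smul]
    linarith
  · intro D _
    rcases Finset.eq_empty_or_nonempty {g ∈ hfin.toFinset |
      DoubleCoset.doubleCoset (a * g * b) (H : Set G) (K : Set G) = D} with he | ⟨g, hg⟩
    · rw [he]; simp
    · simp only [Finset.mem_filter, Set.Finite.mem_toFinset] at hg
      obtain ⟨F, hF, hFN, hgF⟩ := h g hg.1.1
      refine le_trans ?_ hFN
      rw [Set.ncard_eq_toFinset_card _ hF]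
      refine Finset.card_le_card fun g' hg' => ?_
      simp only [Finset.mem_filter, Set.Finite.mem_toFinset] at hg' ⊢
      refine hgF g' hg'.1.1 (DoubleCoset.mem_doubleCoset.1 ?_)
      rw [hg.2, ← hg'.2]
      exact DoubleCoset.mem_doubleCoset_self _ _ _

end IsControlled

/-! ### Finite-to-one maps to the double cosets -/

namespace IsProjectionSystem

variable [ProperSpace X] [ProperlyDiscontinuousSMul G X] [IsIsometricSMul G X]
variable {E Z : Subgroup G} {d : X → X → ℝ} {o : X} {θ : ℝ} {H K : Subgroup G}

/-- The map `g ↦ H a g b K`, for large translations `a` and `b` along axes to which `H`, `K` and `g`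
have bounded projections, is finite-to-one. -/
lemma isControlled (P : IsProjectionSystem E Z d o θ) {p q : G} {D : ℝ}
    (hH : ∀ h ∈ H, d (p⁻¹ • o) (p⁻¹ • h • o) ≤ D) (hK : ∀ k ∈ K, d (q⁻¹ • o) (q⁻¹ • k • o) ≤ D) :
    IsControlled H K o {g : G | d (p⁻¹ • o) (p⁻¹ • g • o) ≤ D ∧
      d (q⁻¹ • o) (q⁻¹ • g⁻¹ • o) ≤ D} := by
  set c := 2 * dist o (p • o) + 2 * dist o (q • o) + 2 * θ + D with hc
  have hp0 : 0 ≤ dist o (p • o) := dist_nonneg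
  have hq0 : 0 ≤ dist o (q • o) := dist_nonneg
  obtain ⟨s, hs, hL⟩ := P.exists_translation (2 * c + 6 * θ + 1)
  have hLi : ∀ x, 2 * c + 6 * θ + 1 ≤ d x (s⁻¹ • x) := fun x => by
    simpa [P.comm] using hL (s⁻¹ • x)
  set W := {g : G | d (p⁻¹ • o) (p⁻¹ • g • o) ≤ D ∧ d (q⁻¹ • o) (q⁻¹ • g⁻¹ • o) ≤ D}
  -- The chain argument needs the sides `p⁻¹ * g * q` outside `E`; the remaining `g` are finitely
  -- many and are controlled trivially.
  have hexc : {g : G | g ∈ W ∧ p⁻¹ * g * q ∈ E}.Finite := by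
    refine ((P.finite (dist o (p • o) + dist o (q • o) + 2 * θ + D)).image
      fun e => p * e * q⁻¹).subset ?_
    rintro g ⟨hg, hE⟩
    exact ⟨p⁻¹ * g * q, ⟨hE, P.le_conj hg.1⟩, by group⟩
  refine ((IsControlled.of_finite hexc).union (T := {g : G | g ∈ W ∧ p⁻¹ * g * q ∉ E}) ?_).mono
    fun g hg => (em (p⁻¹ * g * q ∈ E)).imp (⟨hg, ·⟩) (⟨hg, ·⟩)
  set FH := {h : G | p⁻¹ * h * p ∈ E ∧ d (p⁻¹ • o) (p⁻¹ • h • o) ≤ D} with hFH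
  set FK := {k : G | q⁻¹ * k * q ∈ E ∧ d (q⁻¹ • o) (q⁻¹ • k • o) ≤ D} with hFK
  have hfin : (FH ×ˢ FK).Finite := P.finite_conj_mem.prod P.finite_conj_mem
  set a := p * s * p⁻¹ with ha
  set b := q * s * q⁻¹ with hb
  -- Solving for `g'` makes the fibre an image of pairs `(h, k)`, which have to be confined to the
  -- finite set `FH ×ˢ FK`.
  refine IsControlled.of_fibers a b (N := (FH ×ˢ FK).ncard) fun g ⟨hgW, hgE⟩ =>
    ⟨(fun z : G × G => a⁻¹ * z.1 * a * g * b * z.2 * b⁻¹) '' (FH ×ˢ FK), hfin.image _,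
      Set.ncard_image_le hfin, ?_⟩
  rintro g' ⟨hgW', hgE'⟩ ⟨h, hh, k, hk, heq⟩
  have bg : d o ((p⁻¹ * g * q) • o) ≤ c := (P.le_conj hgW.1).trans (by linarith)
  have bg' : d o ((p⁻¹ * g' * q) • o) ≤ c := (P.le_conj hgW'.1).trans (by linarith)
  have bgi : d o ((q⁻¹ * g⁻¹ * p) • o) ≤ c := (P.le_conj hgW.2).trans (by linarith)
  have bgi' : d o ((q⁻¹ * g'⁻¹ * p) • o) ≤ c := (P.le_conj hgW'.2).trans (by linarith)
  have bh : d o ((p⁻¹ * h * p) • o) ≤ c := (P.le_conj (hH h hh)).trans (by linarith)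
  have bhi : d o ((p⁻¹ * h⁻¹ * p) • o) ≤ c := (P.le_conj (hH _ (inv_mem hh))).trans (by linarith)
  have bk : d o ((q⁻¹ * k * q) • o) ≤ c := (P.le_conj (hK k hk)).trans (by linarith)
  have bki : d o ((q⁻¹ * k⁻¹ * q) • o) ≤ c := (P.le_conj (hK _ (inv_mem hk))).trans (by linarith)
  have ivg : (p⁻¹ * g * q)⁻¹ = q⁻¹ * g⁻¹ * p := by group
  have ivg' : (p⁻¹ * g' * q)⁻¹ = q⁻¹ * g'⁻¹ * p := by group
  have ivh : (p⁻¹ * h * p)⁻¹ = p⁻¹ * h⁻¹ * p := by group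
  have ivk : (q⁻¹ * k * q)⁻¹ = q⁻¹ * k⁻¹ * q := by group
  have hh' : h = a * g' * b * k⁻¹ * b⁻¹ * g⁻¹ * a⁻¹ := by
    rw [heq]; group
  have hk' : k = b⁻¹ * g⁻¹ * a⁻¹ * h⁻¹ * a * g' * b := by
    rw [show b⁻¹ * g⁻¹ * a⁻¹ * h⁻¹ * a * g' * b =
      b⁻¹ * g⁻¹ * a⁻¹ * h⁻¹ * (a * g' * b) by group, heq]
    group
  -- Conjugated to the base axis, `heq` is the quadrilateral of `not_closed_chain`. Read from the
  -- other end, with `s⁻¹` and inverted sides, it settles `h` too.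
  have hkE : q⁻¹ * k * q ∈ E := by
    refine P.not_closed_chain (n := p⁻¹ * h * p) hs hL (by linarith) hgE hgE' ?_ bg' ?_ bk ?_ bh ?_
    · rwa [ivg]
    · rwa [ivg']
    · rwa [ivk]
    · rw [hh', ha, hb]; group
  have hhE : p⁻¹ * h * p ∈ E := by
    refine P.not_closed_chain (s := s⁻¹) (v := (p⁻¹ * g' * q)⁻¹) (v' := (p⁻¹ * g * q)⁻¹)
      (n := q⁻¹ * k * q) (inv_mem hs) hLi (by linarith) (fun hE => hgE' (by simpa using inv_mem hE))
      (fun hE => hgE (by simpa using inv_mem hE)) ?_ ?_ ?_ bh ?_ bk ?_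
    · rwa [inv_inv]
    · rwa [ivg]
    · rwa [inv_inv]
    · rwa [ivh]
    · rw [hk', ha, hb]; group
  refine ⟨(h, k), ⟨⟨hhE, hH h hh⟩, ⟨hkE, hK k hk⟩⟩, ?_⟩
  calc a⁻¹ * h * a * g * b * k * b⁻¹ = a⁻¹ * h * (a * g * b) * k * b⁻¹ := by group
    _ = a⁻¹ * (h * (a * g * b) * k) * b⁻¹ := by group
    _ = g' := by rw [← heq]; group

/-- By `exists_pair` and `le_or_le`, each `g` is bounded on one of two axes for `H`, and `g⁻¹` on
one of two for `K`; the four combinations cover `G`. -/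
theorem isControlled_univ (P : IsProjectionSystem E Z d o θ)
    (hH : ∃ (p : G) (D : ℝ), ∀ h ∈ H, d (p⁻¹ • o) (p⁻¹ • h • o) ≤ D)
    (hK : ∃ (p : G) (D : ℝ), ∀ k ∈ K, d (p⁻¹ • o) (p⁻¹ • k • o) ≤ D) :
    IsControlled H K o univ := by
  obtain ⟨p, p', D₁, hpE, hp, hp'⟩ := P.exists_pair hH
  obtain ⟨q, q', D₂, hqE, hq, hq'⟩ := P.exists_pair hK
  obtain ⟨D₃, h₃⟩ := P.le_or_le hpE
  obtain ⟨D₄, h₄⟩ := P.le_or_le hqE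
  obtain ⟨D, m₁, m₂, m₃, m₄⟩ : ∃ D, D₁ ≤ D ∧ D₂ ≤ D ∧ D₃ ≤ D ∧ D₄ ≤ D :=
    ⟨max (max D₁ D₂) (max D₃ D₄), by simp, by simp, by simp, by simp⟩
  have hp := fun h hh => (hp h hh).trans m₁
  have hp' := fun h hh => (hp' h hh).trans m₁
  have hq := fun k hk => (hq k hk).trans m₂
  have hq' := fun k hk => (hq' k hk).trans m₂
  refine (((P.isControlled hp hq).union (P.isControlled hp hq')).union
    ((P.isControlled hp' hq).union (P.isControlled hp' hq'))).mono fun g _ => ?_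
  rcases h₃ (g • o) with h | h <;> rcases h₄ (g⁻¹ • o) with h' | h'
  · exact Or.inl (Or.inl ⟨h.trans m₃, h'.trans m₄⟩)
  · exact Or.inl (Or.inr ⟨h.trans m₃, h'.trans m₄⟩)
  · exact Or.inr (Or.inl ⟨h.trans m₃, h'.trans m₄⟩)
  · exact Or.inr (Or.inr ⟨h.trans m₃, h'.trans m₄⟩)

end IsProjectionSystem

end Counting

/-! ### Translates of an axis along an escaping orbit sequence -/

namespace IsAxis

variable {G X : Type*} [Group G] [MetricSpace X] [MulAction G X]
variable {f : G} {γ : ℝ → X} {τ l C : ℝ} [ProperSpace X] [IsIsometricSMul G X]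
variable [ProperlyDiscontinuousSMul G X]

/-- Along an escaping orbit sequence there are escaping translates of the axis nearby. -/
lemma exists_escaping_translates (h : IsAxis f γ τ l C) (hX : IsGeodesicSpace X)
    (hG : IsNonElementary G) (o : X) (g : ℕ → G)
    (hg : Tendsto (fun n => dist o (g n • o)) atTop atTop) :
    ∃ (u : ℕ → G) (R : ℝ), (∀ n, dist (g n • o) (u n • γ 0) ≤ R) ∧
      Tendsto (fun n => Metric.infDist ((u n)⁻¹ • o) (range γ)) atTop atTop := by
  obtain ⟨θ, hθ0, hθ⟩ := h.exists_projDist_le hX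
  obtain ⟨t, ht⟩ : ∃ t, t ∉ powerCommensurator f := by
    by_contra! hall
    exact h.powerCommensurator_ne_top hX hG ((Subgroup.eq_top_iff' _).2 hall)
  have hC := h.pos
  -- A point near both the axis and its translate by `t` is confined to a bounded region, because
  -- `t` is outside the commensurator.
  have key : ∀ (R : ℝ) (y : X), Metric.infDist y (range γ) ≤ R →
      Metric.infDist (t⁻¹ • y) (range γ) ≤ R →
      dist o y ≤ 2 * R + 4 * C + θ + dist o (nearest (range γ) (t • γ 0)) := by
    intro R y h1 h2
    rw [← h.dist_nearest] at h1 h2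
    have h3 := h.projDist_le hX y (t • nearest (range γ) (t⁻¹ • y))
    rw [← dist_smul t⁻¹ y, inv_smul_smul] at h3
    have h4 := hθ t ht _ (h.nearest_mem (t⁻¹ • y)) (γ 0) (mem_range_self 0)
    have h5 := dist_triangle4 o (nearest (range γ) (t • γ 0)) (nearest (range γ) y) y
    have h6 := projDist_triangle (A := range γ) y (t • nearest (range γ) (t⁻¹ • y)) (t • γ 0)
    unfold projDist at *
    rw [dist_comm (nearest (range γ) (t • γ 0)), dist_comm (nearest (range γ) y) y] at h5
    linarith
  -- Of the translates by `g n` and by `g n * t`, take the one farther from `o`.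
  have hc : ∀ n, ∃ c : G, (c = 1 ∨ c = t) ∧ ∀ R, Metric.infDist ((g n * c)⁻¹ • o) (range γ) ≤ R →
      dist o (g n • o) ≤ 2 * R + 4 * C + θ + dist o (nearest (range γ) (t • γ 0)) := by
    intro n
    have hd : dist o (g n • o) = dist o ((g n)⁻¹ • o) := by
      rw [← dist_smul (g n)⁻¹, inv_smul_smul, dist_comm]
    rw [hd]
    rcases le_total (Metric.infDist ((g n)⁻¹ • o) (range γ))
      (Metric.infDist (t⁻¹ • (g n)⁻¹ • o) (range γ)) with hle | hle
    · refine ⟨t, Or.inr rfl, fun R hR => ?_⟩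
      rw [mul_inv_rev, mul_smul] at hR
      exact key R _ (hle.trans hR) hR
    · refine ⟨1, Or.inl rfl, fun R hR => ?_⟩
      rw [mul_one] at hR
      exact key R _ hR (hle.trans hR)
  choose c hc1 hc using hc
  refine ⟨fun n => g n * c n, max (dist o (γ 0)) (dist o (t • γ 0)), fun n => ?_, ?_⟩
  · rw [mul_smul, dist_smul]
    rcases hc1 n with h1 | h1 <;> rw [h1]
    · rw [one_smul]; exact le_max_left _ _
    · exact le_max_right _ _
  · refine tendsto_atTop.2 fun R => ?_
    filter_upwards [tendsto_atTop.1 hg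
      (2 * R + 4 * C + θ + dist o (nearest (range γ) (t • γ 0)) + 1)] with n hn
    by_contra! hlt
    linarith [hc n R hlt.le]

end IsAxis

/-! ### Sequences that converge to the boundary -/

section Boundary

/-- First countability makes accumulation points of the `G`-orbit limits of sequences, so every
class of the full limit set already comes from `H`. -/
lemma not_isSecondType {X Y G : Type*} [TopologicalSpace Y] [Group G] [MulAction G X]
    {ι : X → Y} {P : Setoid (bdry ι)} {H : Subgroup G} {o : X}
    (h : ∀ ξ : bdry ι, ∀ g : ℕ → G, Tendsto (fun n => ι (g n • o)) atTop (𝓝 (ξ : Y)) →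
      ∃ η : bdry ι, P η ξ ∧ ∃ k : ℕ → G, (∀ n, k n ∈ H) ∧
        Tendsto (fun n => ι (k n • o)) atTop (𝓝 (η : Y)))
    [FirstCountableTopology Y] : ¬ IsSecondType P H o := by
  intro hH
  refine hH.2 ?_
  rintro ξ ⟨ζ, hζ, hζξ⟩
  obtain ⟨y, hy, hyζ⟩ := mem_closure_iff_seq_limit.1 hζ
  have : ∀ n, ∃ g : G, ι (g • o) = y n := fun n => by
    obtain ⟨_, ⟨g, -, rfl⟩, hg⟩ := hy n
    exact ⟨g, hg⟩
  choose g hg using this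
  obtain ⟨η, hη, k, hk, hkη⟩ := h ζ g (by simpa only [hg] using hyζ)
  refine ⟨η, ?_, P.trans hη hζξ⟩
  exact mem_closure_of_tendsto hkη (Eventually.of_forall fun n => ⟨_, ⟨k n, hk n, rfl⟩, rfl⟩)

variable {X Y : Type*} [MetricSpace X] [TopologicalSpace Y]

/-- Closed balls have compact, hence closed, images, and these contain no boundary point. -/
lemma tendsto_dist_of_tendsto_bdry [ProperSpace X] [T2Space Y] {ι : X → Y} (hι : Continuous ι)
    (o : X) {x : ℕ → X} {ξ : bdry ι} (h : Tendsto (fun n => ι (x n)) atTop (𝓝 (ξ : Y))) :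
    Tendsto (fun n => dist o (x n)) atTop atTop := by
  refine tendsto_atTop.2 fun R => ?_
  have hcl : IsClosed (ι '' Metric.closedBall o R) :=
    ((isCompact_closedBall o R).image hι).isClosed
  have hξ : (ξ : Y) ∈ (ι '' Metric.closedBall o R)ᶜ := fun hm =>
    ξ.2.2 (image_subset_range _ _ hm)
  filter_upwards [h (hcl.isOpen_compl.mem_nhds hξ)] with n hn
  by_contra! hlt
  exact hn ⟨x n, by rw [Metric.mem_closedBall, dist_comm]; exact hlt.le, rfl⟩

end Boundary

/-! ### Convergence boundaries -/

section Convergence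

variable {X : Type*} [MetricSpace X]

/-- Allows the cone axiom to be applied to short geodesics. Unit speed holds since the variation
agrees with that of the identity. -/
lemma IsGeodesicOn.isQuasiGeodesic {c : ℝ → X} {a b : ℝ} (hc : IsGeodesicOn c a b) (hab : a ≤ b) :
    IsQuasiGeodesic 1 c (Icc a b) where
  one_le := le_rfl
  nonempty := nonempty_Icc.2 hab
  isClosed := isClosed_Icc
  ordConnected := ordConnected_Icc
  unitSpeed := by
    refine hasConstantSpeedOnWith_iff_ordered.2 fun s hs t ht hst => ?_
    have hsub : Icc a b ∩ Icc s t = Icc s t := inter_eq_right.2 (Icc_subset_Icc hs.1 ht.2)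
    rw [hsub]
    have hid : eVariationOn c (Icc s t) = eVariationOn (id : ℝ → ℝ) (Icc s t) := by
      refine iSup_congr fun p => Finset.sum_congr rfl fun i _ => ?_
      have h1 := p.2.2.2 (i + 1)
      have h2 := p.2.2.2 i
      rw [edist_dist, edist_dist, hc _ ⟨hs.1.trans h1.1, h1.2.trans ht.2⟩ _
        ⟨hs.1.trans h2.1, h2.2.trans ht.2⟩, id, id, Real.dist_eq]
    rw [hid]
    simpa only [inter_self, id, one_mul, NNReal.coe_one] using
      (monotone_id.monotoneOn (Icc s t)).eVariationOn_eq (left_mem_Icc.2 hst) (right_mem_Icc.2 hst)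
  length_le := fun s hs t ht => by rw [hc s hs t ht]; linarith

lemma self_mem_cone (hX : IsGeodesicSpace X) (o x : X) : x ∈ cone o {x} := by
  obtain ⟨σ, hσ⟩ := hX o x
  obtain ⟨c, -, h1, -, rfl⟩ := id hσ
  exact ⟨_, hσ, x, ⟨_, right_mem_Icc.2 dist_nonneg, h1⟩, rfl⟩

lemma cone_mono {o : X} {A B : Set X} (h : A ⊆ B) : cone o A ⊆ cone o B :=
  fun _ ⟨σ, hσ, hne⟩ => ⟨σ, hσ, hne.mono (inter_subset_inter_right σ h)⟩

lemma isQuasiGeodesic_smul {G : Type*} [Group G] [MulAction G X] [IsIsometricSMul G X]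
    (u : G) {l : ℝ} {γ : ℝ → X} {I : Set ℝ}
    (h : IsQuasiGeodesic l γ I) : IsQuasiGeodesic l (fun t => u • γ t) I where
  one_le := h.one_le
  nonempty := h.nonempty
  isClosed := h.isClosed
  ordConnected := h.ordConnected
  unitSpeed := by
    intro s hs t ht
    rw [← h.unitSpeed hs ht]
    exact iSup_congr fun p => Finset.sum_congr rfl fun i _ => edist_smul_left _ _ _
  length_le := fun s hs t ht => by rw [dist_smul]; exact h.length_le s hs t ht

lemma proj_smul {G : Type*} [Group G] [MulAction G X] [IsIsometricSMul G X]
    (u : G) (A : Set X) (x : X) {a : X}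
    (ha : a ∈ proj ((u • ·) '' A) x) : u⁻¹ • a ∈ proj A (u⁻¹ • x) := by
  obtain ⟨⟨b, hb, rfl⟩, h⟩ := ha
  refine ⟨by simpa, ?_⟩
  rw [dist_smul, h, ← Metric.infDist_image (isometry_smul X u) (x := u⁻¹ • x), smul_inv_smul]

lemma isContracting_smul {G : Type*} [Group G] [MulAction G X] [IsIsometricSMul G X]
    (u : G) {C : ℝ} {A : Set X}
    (h : IsContracting C A) : IsContracting C ((u • ·) '' A) := by
  rintro _ x y ⟨c, rfl, h1, hc, rfl⟩ hfar _ ⟨s, hs, rfl⟩ _ ⟨t, ht, rfl⟩ a ha b hb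
  have hL : 0 ≤ dist (c 0) y := dist_nonneg
  have hc' : IsGeodesicOn (fun r => u⁻¹ • c r) 0 (dist (c 0) y) := IsGeodesicOn.smul hc u⁻¹
  rw [← dist_smul u⁻¹]
  refine h _ _ _ (hc'.isGeodesicSegment hL) ?_ _ ⟨s, hs, rfl⟩ _ ⟨t, ht, rfl⟩ _
    (proj_smul u A _ ha) _ (proj_smul u A _ hb)
  rintro _ ⟨r, hr, rfl⟩
  have := hfar _ ⟨r, hr, rfl⟩
  rwa [← smul_inv_smul u (c r), Metric.infDist_image (isometry_smul X u)] at this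

namespace IsConvergenceCompactification

variable {Y : Type*} [TopologicalSpace Y] {ι : X → Y} {P : Setoid (bdry ι)}

/-- Two sequences in the cones over an escaping sequence of contracting quasi-geodesics that
converge, converge to the same class. -/
lemma rel_of_mem_cone (hP : IsConvergenceCompactification ι P) {C : ℝ} (hC : 0 < C)
    {γ : ℕ → ℝ → X} {I : ℕ → Set ℝ} (hγ : ∀ n, ∃ l : ℝ, IsQuasiGeodesic l (γ n) (I n))
    (hγC : ∀ n, IsContracting C (γ n '' I n)) (hesc : IsEscaping (fun n => γ n '' I n)) (o : X)
    {x y : ℕ → X} (hx : ∀ n, x n ∈ cone o (γ n '' I n)) (hy : ∀ n, y n ∈ cone o (γ n '' I n))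
    {ξ η : bdry ι} (hξ : Tendsto (fun n => ι (x n)) atTop (𝓝 (ξ : Y)))
    (hη : Tendsto (fun n => ι (y n)) atTop (𝓝 (η : Y))) : P ξ η := by
  obtain ⟨φ, hφ, ζ, hζ⟩ := hP.cones_tendsto C γ I hC hγ hγC hesc o
  obtain ⟨ζ₁, rfl, h₁⟩ := hζ id (fun k => x (φ k)) ξ strictMono_id (fun k => hx _)
    (hξ.comp hφ.tendsto_atTop)
  obtain ⟨ζ₂, rfl, h₂⟩ := hζ id (fun k => y (φ k)) η strictMono_id (fun k => hy _)
    (hη.comp hφ.tendsto_atTop)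
  exact P.trans (P.symm h₁) h₂

/-- Points behind two sequences of points at bounded distance converge to the same class. -/
lemma rel_of_dist_le (hP : IsConvergenceCompactification ι P) (hX : IsGeodesicSpace X) (o : X)
    {R : ℝ} {p q x y : ℕ → X} (hpq : ∀ n, dist (p n) (q n) ≤ R)
    (hp : Tendsto (fun n => dist o (p n)) atTop atTop) (hx : ∀ n, x n ∈ cone o {p n})
    (hy : ∀ n, y n ∈ cone o {q n}) {ξ η : bdry ι}
    (hξ : Tendsto (fun n => ι (x n)) atTop (𝓝 (ξ : Y)))
    (hη : Tendsto (fun n => ι (y n)) atTop (𝓝 (η : Y))) : P ξ η := by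
  choose c h0 h1 hc using fun n => hX.exists_isGeodesicOn (p n) (q n)
  have hR : 0 ≤ R := dist_nonneg.trans (hpq 0)
  have hbd : ∀ n, ∀ s ∈ Icc 0 (dist (p n) (q n)), ∀ t ∈ Icc 0 (dist (p n) (q n)),
      dist (c n s) (c n t) ≤ R := by
    intro n s hs t ht
    rw [hc n s hs t ht]
    refine le_trans ?_ (hpq n)
    rw [abs_le]; constructor <;> linarith [hs.1, hs.2, ht.1, ht.2]
  -- The geodesics `[p n, q n]` have diameter at most `R` and are trivially contracting; the 1 makes
  -- the constant positive.
  refine hP.rel_of_mem_cone (C := R + 1) (by linarith) (γ := c)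
    (I := fun n => Icc 0 (dist (p n) (q n))) (fun n => ⟨1, (hc n).isQuasiGeodesic dist_nonneg⟩)
    (fun n => ?_) ?_ o (fun n => cone_mono ?_ (hx n)) (fun n => cone_mono ?_ (hy n)) hξ hη
  · rintro - - - - - - - - - _ ⟨⟨s, hs, rfl⟩, -⟩ _ ⟨⟨t, ht, rfl⟩, -⟩
    linarith [hbd n s hs t ht]
  · intro o' S
    filter_upwards [tendsto_atTop.1 hp (S + R + dist o o')] with n hn
    rintro _ ⟨s, hs, rfl⟩
    have h2 := hbd n s hs 0 (left_mem_Icc.2 dist_nonneg)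
    rw [h0] at h2
    linarith [dist_triangle4 o o' (c n s) (p n)]
  · exact singleton_subset_iff.2 ⟨0, left_mem_Icc.2 dist_nonneg, h0 n⟩
  · exact singleton_subset_iff.2 ⟨_, right_mem_Icc.2 dist_nonneg, h1 n⟩

/-- As `ι` is an embedding, a limit in its range would be a limit in `X`, where the sequence
diverges. -/
lemma exists_bdry_of_tendsto (hP : IsConvergenceCompactification ι P) {o : X} {x : ℕ → X}
    (hx : Tendsto (fun n => dist o (x n)) atTop atTop) {y : Y}
    (hy : Tendsto (fun n => ι (x n)) atTop (𝓝 y)) : ∃ η : bdry ι, (η : Y) = y := by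
  refine ⟨⟨y, hP.denseRange y, ?_⟩, rfl⟩
  rintro ⟨z, rfl⟩
  have h1 : Tendsto x atTop (𝓝 z) := hP.isOpenEmbedding.toIsEmbedding.tendsto_nhds_iff.2 hy
  exact not_tendsto_atTop_of_tendsto_nhds (tendsto_const_nhds.dist h1) hx

variable {G : Type*} [Group G] [MulAction G X]

variable [ProperSpace X] [IsIsometricSMul G X] [ProperlyDiscontinuousSMul G X]

/-- A subgroup of second type has a bounded projection to a translate of the axis. -/
theorem exists_bounded_projection [CompactSpace Y] [TopologicalSpace.MetrizableSpace Y]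
    (hP : IsConvergenceCompactification ι P)
    (hX : IsGeodesicSpace X) (hG : IsNonElementary G) {f : G} {γ : ℝ → X} (hf : IsQuasiAxis f γ)
    (o : X) {H : Subgroup G} (hH : IsSecondType P H o) :
    ∃ (p : G) (D : ℝ), ∀ h ∈ H, projDist (range γ) (p⁻¹ • o) (p⁻¹ • h • o) ≤ D := by
  obtain ⟨τ, l, C, h⟩ := hf.exists_isAxis
  obtain ⟨-, -, ⟨lγ, hlγ⟩, -⟩ := id hf
  have hC := h.pos
  by_contra! hunb
  refine not_isSecondType (fun ξ g hg => ?_) hH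
  have hgd := tendsto_dist_of_tendsto_bdry hP.isOpenEmbedding.continuous o hg
  obtain ⟨u, R, hR, hu⟩ := h.exists_escaping_translates hX hG o g hgd
  choose k hkH hk using fun n => hunb (u n) C
  -- the projection of `o` to the translate, and a nearby point on a geodesic
  set w : ℕ → X := fun n => u n • nearest (range γ) ((u n)⁻¹ • o) with hw
  have hpt : ∀ n, ∃ p, dist p (w n) ≤ 2 * C ∧ k n • o ∈ cone o {p} := by
    intro n
    obtain ⟨c, h0, h1, hc⟩ := hX.exists_isGeodesicOn o (k n • o)
    have hc' := hc.smul (u n)⁻¹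
    obtain ⟨s, t, hs, hst, ht, -, -, hs', -⟩ := h.isContracting.exists_entry_exit h.isClosed_range
      h.nonempty_range hC.le hc' dist_nonneg (h.nearest_mem_proj _) (h.nearest_mem_proj _)
      (by rw [h0, h1]; exact hk n)
    refine ⟨c s, ?_, ?_⟩
    · rw [← dist_smul (u n)⁻¹, hw, inv_smul_smul]
      simpa only [h0] using hs'
    · refine ⟨c '' Icc 0 (dist o (k n • o)),
        by simpa only [h0, h1] using hc.isGeodesicSegment dist_nonneg, c s,
        ⟨s, ⟨hs, hst.trans ht⟩, rfl⟩, rfl⟩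
  choose p hpw hpk using hpt
  have hinf : ∀ n t, Metric.infDist ((u n)⁻¹ • o) (range γ) ≤ dist o (u n • γ t) := by
    intro n t
    rw [← dist_smul (u n)⁻¹, inv_smul_smul]
    exact Metric.infDist_le_dist_of_mem (mem_range_self t)
  have hwmem : ∀ n, ∃ t, w n = u n • γ t := fun n => by
    obtain ⟨t, ht⟩ := h.nearest_mem ((u n)⁻¹ • o)
    exact ⟨t, by rw [ht]⟩
  have hwd : Tendsto (fun n => dist o (w n)) atTop atTop :=
    tendsto_atTop_mono (fun n => by obtain ⟨t, ht⟩ := hwmem n; rw [ht]; exact hinf n t) hu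
  have hvd : Tendsto (fun n => dist o (u n • γ 0)) atTop atTop :=
    tendsto_atTop_mono (fun n => hinf n 0) hu
  have hkd : Tendsto (fun n => dist o (k n • o)) atTop atTop := by
    refine tendsto_atTop_mono (fun n => ?_) (tendsto_atTop_add_const_right _ (-(2 * C)) hwd)
    obtain ⟨_, ⟨c, h0, h1, hc, rfl⟩, _, ⟨s, hs, rfl⟩, hsp⟩ := hpk n
    rw [mem_singleton_iff] at hsp
    have h2 := hc 0 (left_mem_Icc.2 dist_nonneg) s hs
    rw [h0, hsp, zero_sub, abs_neg, abs_of_nonneg hs.1] at h2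
    linarith [dist_triangle o (p n) (w n), hpw n, hs.2]
  obtain ⟨⟨y₁, y₂, y₃⟩, φ, hφ, hlim⟩ := CompactSpace.tendsto_subseq
    fun n => (ι (u n • γ 0), ι (w n), ι (k n • o))
  rw [nhds_prod_eq, nhds_prod_eq, tendsto_prod_iff'] at hlim
  obtain ⟨l₁, l₂⟩ := hlim
  rw [tendsto_prod_iff'] at l₂
  obtain ⟨l₂, l₃⟩ := l₂
  obtain ⟨ξ₁, rfl⟩ := hP.exists_bdry_of_tendsto (hvd.comp hφ.tendsto_atTop) l₁
  obtain ⟨ξ₂, rfl⟩ := hP.exists_bdry_of_tendsto (hwd.comp hφ.tendsto_atTop) l₂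
  obtain ⟨ξ₃, rfl⟩ := hP.exists_bdry_of_tendsto (hkd.comp hφ.tendsto_atTop) l₃
  -- The classes are linked in three steps: `g n • o` is near `u n • γ 0`, which shares a translate
  -- of the axis with `w n`, and a geodesic to `k n • o` passes near `w n`.
  have r₁ : P ξ ξ₁ := hP.rel_of_dist_le hX o (fun n => hR (φ n)) (hgd.comp hφ.tendsto_atTop)
    (fun n => self_mem_cone hX o _) (fun n => self_mem_cone hX o _)
    (hg.comp hφ.tendsto_atTop) l₁
  have r₂ : P ξ₁ ξ₂ := by
    have himg : ∀ n, (fun t => u (φ n) • γ t) '' univ = (u (φ n) • ·) '' range γ := fun n => by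
      rw [image_univ, ← range_comp]; rfl
    refine hP.rel_of_mem_cone hC (γ := fun n t => u (φ n) • γ t) (I := fun _ => univ)
      (fun n => ⟨lγ, isQuasiGeodesic_smul _ hlγ⟩) (fun n => ?_) ?_ o
      (fun n => cone_mono ?_ (self_mem_cone hX o (u (φ n) • γ 0)))
      (fun n => cone_mono ?_ (self_mem_cone hX o (w (φ n)))) l₁ l₂
    · rw [himg]; exact isContracting_smul _ h.isContracting
    · intro o' S
      filter_upwards [tendsto_atTop.1 (hu.comp hφ.tendsto_atTop) (S + dist o o')] with n hn
      rintro _ ⟨t, -, rfl⟩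
      have := hinf (φ n) t
      simp only [Function.comp_apply] at hn ⊢
      linarith [dist_triangle o o' (u (φ n) • γ t)]
    · exact singleton_subset_iff.2 ⟨0, trivial, rfl⟩
    · obtain ⟨t, ht⟩ := hwmem (φ n)
      exact singleton_subset_iff.2 ⟨t, trivial, ht.symm⟩
  have r₃ : P ξ₂ ξ₃ := hP.rel_of_dist_le hX o (R := 2 * C) (p := fun n => w (φ n))
    (q := fun n => p (φ n)) (fun n => by rw [dist_comm]; exact hpw _)
    (hwd.comp hφ.tendsto_atTop) (fun n => self_mem_cone hX o _) (fun n => hpk _) l₂ l₃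
  exact ⟨ξ₃, P.symm (P.trans (P.trans r₁ r₂) r₃), fun n => k (φ n), fun n => hkH _, l₃⟩

end IsConvergenceCompactification

end Convergence

/-! ### The horofunction boundary -/

section Horofunction

variable {X : Type*} [MetricSpace X]

@[simp] lemma horo_apply (o y x : X) : horo o y x = dist x y - dist o y := rfl

lemma continuous_horo (o : X) : Continuous (horo o) := by
  refine ContinuousMap.continuous_of_continuous_uncurry _ ?_
  simp only [Function.uncurry_def, horo_apply]
  fun_prop

/-- Arzelà–Ascoli: the functions are equicontinuous, and bounded at `x` by the distance to `o`. -/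
lemma isCompact_lipschitz_functions (o : X) :
    IsCompact {F : C(X, ℝ) | (∀ x y, |F x - F y| ≤ dist x y) ∧ F o = 0} := by
  refine ArzelaAscoli.isCompact_of_equicontinuous _ ?_ ?_
  · have heq : ContinuousMap.toFun ''
        {F : C(X, ℝ) | (∀ x y, |F x - F y| ≤ dist x y) ∧ F o = 0} =
        {F : X → ℝ | (∀ x y, |F x - F y| ≤ dist x y) ∧ F o = 0} := by
      ext F
      constructor
      · rintro ⟨F, hF, rfl⟩
        exact hF
      · intro hF
        have hc : Continuous F := (LipschitzWith.of_dist_le_mul (K := 1) fun x y => by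
          simpa [Real.dist_eq] using hF.1 x y).continuous
        exact ⟨⟨F, hc⟩, hF, rfl⟩
    rw [heq]
    refine (isCompact_univ_pi fun x =>
      isCompact_Icc (a := -dist x o) (b := dist x o)).of_isClosed_subset ?_ ?_
    · simp only [ofPred_and, ofPred_forall]
      refine (isClosed_iInter fun x => isClosed_iInter fun y => ?_).inter ?_
      · exact isClosed_le (by fun_prop) (by fun_prop)
      · exact isClosed_eq (by fun_prop) (by fun_prop)
    · rintro F ⟨hF, h0⟩ x -
      have := hF x o
      rw [h0, sub_zero] at this
      exact abs_le.1 this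
  · refine (LipschitzWith.uniformEquicontinuous _ 1 fun F => ?_).equicontinuous
    exact LipschitzWith.of_dist_le_mul fun x y => by
      simpa [Real.dist_eq] using F.2.1 x y

lemma horo_mem_lipschitz (o y : X) :
    horo o y ∈ {F : C(X, ℝ) | (∀ x z, |F x - F z| ≤ dist x z) ∧ F o = 0} := by
  refine ⟨fun x z => ?_, by simp⟩
  simp only [horo_apply, sub_sub_sub_cancel_right]
  exact abs_dist_sub_le x z y

lemma tendsto_eval {F : ℕ → C(X, ℝ)} {F₀ : C(X, ℝ)} (h : Tendsto F atTop (𝓝 F₀)) (x : X) :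
    Tendsto (fun n => F n x) atTop (𝓝 (F₀ x)) :=
  ((continuous_eval_const x).tendsto F₀).comp h

/-- One unit along a geodesic from `y` towards `x n` the function `horo o (x n)` drops by 1. A
cluster point `w` of these unit steps would lie below the value at `y`, where `horo o y` is minimal.
-/
lemma not_tendsto_horo [ProperSpace X] (hX : IsGeodesicSpace X) {o : X} {x : ℕ → X}
    (hx : Tendsto (fun n => dist o (x n)) atTop atTop) (y : X) :
    ¬ Tendsto (fun n => horo o (x n)) atTop (𝓝 (horo o y)) := by
  intro hlim
  have hz : ∀ n, ∃ z ∈ Metric.closedBall y 1,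
      1 ≤ dist y (x n) → dist z (x n) = dist y (x n) - 1 := by
    intro n
    by_cases h1 : 1 ≤ dist y (x n)
    · obtain ⟨c, h0, hL, hc⟩ := hX.exists_isGeodesicOn y (x n)
      have e1 := hc.dist_eq zero_le_one h1 le_rfl
      have e2 := hc.dist_eq le_rfl zero_le_one h1
      rw [hL] at e1
      rw [h0] at e2
      exact ⟨c 1, by rw [Metric.mem_closedBall, dist_comm, e2]; simp, fun _ => e1⟩
    · exact ⟨y, by simp, fun h => absurd h h1⟩
  choose z hz hz1 using hz
  obtain ⟨w, -, φ, hφ, hw⟩ := (isCompact_closedBall y 1).tendsto_subseq hz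
  have hw0 : Tendsto (fun n => dist w (z (φ n))) atTop (𝓝 0) := by
    simpa [dist_comm] using (tendsto_iff_dist_tendsto_zero.1 hw)
  have hev : ∀ᶠ n in atTop, horo o (x (φ n)) w - horo o (x (φ n)) y ≤ -1 + dist w (z (φ n)) := by
    filter_upwards [hφ.tendsto_atTop.eventually (tendsto_atTop.1 hx (1 + dist o y))] with n hn
    have h2 := hz1 (φ n) (by linarith [dist_triangle o y (x (φ n))])
    simp only [horo_apply]
    linarith [dist_triangle w (z (φ n)) (x (φ n))]
  have h3 := le_of_tendsto_of_tendsto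
    (((tendsto_eval hlim w).comp hφ.tendsto_atTop).sub
      ((tendsto_eval hlim y).comp hφ.tendsto_atTop))
    (hw0.const_add (-1)) hev
  simp only [horo_apply, dist_self] at h3
  linarith [dist_nonneg (x := w) (y := y)]

lemma exists_bdry_horo_subseq [ProperSpace X] (hX : IsGeodesicSpace X) {o : X} {x : ℕ → X}
    (hx : Tendsto (fun n => dist o (x n)) atTop atTop) :
    ∃ η : bdry (horo o), ∃ φ : ℕ → ℕ, StrictMono φ ∧
      Tendsto (fun n => horo o (x (φ n))) atTop (𝓝 (η : C(X, ℝ))) := by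
  obtain ⟨F, -, φ, hφ, hF⟩ := (isCompact_lipschitz_functions o).tendsto_subseq
    fun n => horo_mem_lipschitz o (x n)
  refine ⟨⟨F, mem_closure_of_tendsto hF (Eventually.of_forall fun n => ⟨_, rfl⟩), ?_⟩, φ, hφ, hF⟩
  rintro ⟨y, rfl⟩
  exact not_tendsto_horo hX (hx.comp hφ.tendsto_atTop) y hF

end Horofunction

/-! ### Distance differences seen through an axis -/

namespace IsAxis

variable {G X : Type*} [Group G] [MetricSpace X] [MulAction G X]
variable {f : G} {γ : ℝ → X} {τ l C : ℝ} [ProperSpace X]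

lemma projDist_le_of_far (h : IsAxis f γ τ l C) (hX : IsGeodesicSpace X) {o z : X}
    (hz : dist o z + C ≤ Metric.infDist o (range γ)) : projDist (range γ) o z ≤ C := by
  obtain ⟨c, h0, h1, hc⟩ := hX.exists_isGeodesicOn o z
  refine h.isContracting.dist_le hc dist_nonneg (fun t ht => ?_)
    (by rw [h0]; exact h.nearest_mem_proj o) (by rw [h1]; exact h.nearest_mem_proj z)
  have h2 := Metric.infDist_le_infDist_add_dist (s := range γ) (x := c 0) (y := c t)
  rw [hc.dist_eq le_rfl ht.1 ht.2, h0] at h2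
  linarith [ht.2]

/-- A geodesic to a point with a distant projection passes close to the projection. -/
lemma abs_dist_sub_le_of_lt (h : IsAxis f γ τ l C) (hX : IsGeodesicSpace X) {x y w : X} {ε : ℝ}
    (hxy : C < projDist (range γ) x y) (hw : dist (nearest (range γ) x) w ≤ ε) :
    |dist x y - (dist x w + dist w y)| ≤ 2 * (2 * C + ε) := by
  obtain ⟨c, h0, h1, hc⟩ := hX.exists_isGeodesicOn x y
  obtain ⟨s, t, hs, hst, ht, -, -, hs', -⟩ := h.isContracting.exists_entry_exit h.isClosed_range
    h.nonempty_range h.pos.le hc dist_nonneg (h.nearest_mem_proj _) (h.nearest_mem_proj _)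
    (by rw [h0, h1]; exact hxy)
  rw [h0] at hs'
  have e1 := hc.dist_eq le_rfl hs (hst.trans ht)
  have e2 := hc.dist_eq hs (hst.trans ht) le_rfl
  rw [h0] at e1
  rw [h1] at e2
  have e3 : dist (c s) w ≤ 2 * C + ε :=
    (dist_triangle _ (nearest (range γ) x) _).trans (by linarith)
  have e4 := dist_triangle x (c s) w
  have e5 := dist_triangle_left w y (c s)
  have e6 := dist_triangle_right x (c s) w
  have e7 := dist_triangle (c s) w y
  rw [abs_le]; constructor <;> linarith

/-- Geodesics to `y` from `o` and from `z` both pass near the projection of `o`, which may therefore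
replace `y`; the errors are `4 * C` and `6 * C`. -/
lemma abs_dist_sub_dist_sub_le (h : IsAxis f γ τ l C) (hX : IsGeodesicSpace X) {o z y : X}
    (hz : projDist (range γ) o z ≤ C) (hy : 2 * C < projDist (range γ) o y) :
    |dist z y - dist o y - (dist z (nearest (range γ) o) - dist o (nearest (range γ) o))| ≤
      10 * C := by
  have hC := h.pos
  have h1 := h.abs_dist_sub_le_of_lt hX (x := o) (y := y) (by linarith) (dist_self _).le
  have h2 := h.abs_dist_sub_le_of_lt hX (x := z) (y := y) (w := nearest (range γ) o)
    (ε := C) (by linarith [projDist_triangle (A := range γ) o z y]) (by rw [dist_comm]; exact hz)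
  rw [abs_le] at *
  constructor <;> linarith [h1.1, h1.2, h2.1, h2.2]

/-- If `o` and `y` have close projections, then `y` itself is within `R + 2 * C` of the projection
of `o`. -/
lemma abs_dist_sub_dist_sub_le_of_near (h : IsAxis f γ τ l C) (hX : IsGeodesicSpace X) {o z y : X}
    {R : ℝ} (hz : projDist (range γ) o z ≤ C) (hy : Metric.infDist y (range γ) ≤ R) :
    |dist z y - dist o y - (dist z (nearest (range γ) o) - dist o (nearest (range γ) o))| ≤
      10 * C + 2 * R := by
  have hC := h.pos
  have hR : 0 ≤ R := Metric.infDist_nonneg.trans hy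
  rcases lt_or_ge (2 * C) (projDist (range γ) o y) with hlt | hge
  · exact (h.abs_dist_sub_dist_sub_le hX hz hlt).trans (by linarith)
  · rw [← h.dist_nearest] at hy
    have h1 : dist y (nearest (range γ) o) ≤ R + 2 * C := by
      rw [projDist_comm] at hge
      exact (dist_triangle _ _ _).trans (add_le_add hy hge)
    have h2 := abs_dist_sub_le y (nearest (range γ) o) z
    have h3 := abs_dist_sub_le y (nearest (range γ) o) o
    rw [dist_comm y z, dist_comm _ z] at h2
    rw [dist_comm y o, dist_comm _ o] at h3
    rw [abs_le] at *
    constructor <;> linarith [h2.1, h2.2, h3.1, h3.2]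

variable [IsIsometricSMul G X] [ProperlyDiscontinuousSMul G X]

/-- A subgroup of second type has a bounded projection to a translate of the axis. -/
theorem exists_bounded_projection (h : IsAxis f γ τ l C) (hX : IsGeodesicSpace X)
    (hG : IsNonElementary G) (o : X) {H : Subgroup G}
    (hH : IsSecondType (finiteDifference o) H o) :
    ∃ (p : G) (D : ℝ), ∀ h ∈ H, projDist (range γ) (p⁻¹ • o) (p⁻¹ • h • o) ≤ D := by
  have hC := h.pos
  by_contra! hunb
  refine not_isSecondType (fun ξ g hg => ?_) hH
  have hgd := tendsto_dist_of_tendsto_bdry (continuous_horo o) o hg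
  obtain ⟨u, R, hR, hu⟩ := h.exists_escaping_translates hX hG o g hgd
  choose k hkH hk using fun n => hunb (u n) (2 * C)
  have hkd : Tendsto (fun n => dist o (k n • o)) atTop atTop := by
    refine tendsto_atTop_mono (fun n => ?_) (tendsto_atTop_add_const_right _ (-(4 * C)) hu)
    have h1 := h.abs_dist_sub_le_of_lt hX (x := (u n)⁻¹ • o) (y := (u n)⁻¹ • k n • o)
      (by linarith [hk n]) (dist_self _).le
    rw [h.dist_nearest, dist_smul] at h1
    linarith [(abs_le.1 h1).1, dist_nonneg (x := nearest (range γ) ((u n)⁻¹ • o))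
      (y := (u n)⁻¹ • k n • o)]
  obtain ⟨η, φ, hφ, hη⟩ := exists_bdry_horo_subseq hX hkd
  refine ⟨η, ⟨20 * C + 2 * R, fun z => ?_⟩, fun n => k (φ n), fun n => hkH _, hη⟩
  have hlim : Tendsto (fun n => |horo o (k (φ n) • o) z - horo o (g (φ n) • o) z|) atTop
      (𝓝 |(η : C(X, ℝ)) z - (ξ : C(X, ℝ)) z|) :=
    ((tendsto_eval hη z).sub ((tendsto_eval hg z).comp hφ.tendsto_atTop)).abs
  refine le_of_tendsto hlim ?_
  -- For fixed `z` the escaping translates eventually see `o` and `z` at nearby projections. Both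
  -- distance differences then approximate the same quantity, within `10 * C` for `k` and `10 * C +
  -- 2 * R` for `g`.
  filter_upwards [hφ.tendsto_atTop.eventually (tendsto_atTop.1 hu (dist o z + C))] with n hn
  generalize φ n = m at hn ⊢
  have hz : projDist (range γ) ((u m)⁻¹ • o) ((u m)⁻¹ • z) ≤ C :=
    h.projDist_le_of_far hX (by rwa [dist_smul])
  have h1 := h.abs_dist_sub_dist_sub_le hX hz (hk m)
  have h2 := h.abs_dist_sub_dist_sub_le_of_near hX (y := (u m)⁻¹ • g m • o) (R := R) hz (by
    refine (Metric.infDist_le_dist_of_mem (mem_range_self 0)).trans ?_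
    rw [← dist_smul (u m), smul_inv_smul]
    exact hR m)
  simp only [dist_smul] at h1 h2
  simp only [horo_apply]
  rw [abs_le] at *
  constructor <;> linarith [h1.1, h1.2, h2.1, h2.2]

end IsAxis

/-! ### Growth -/

section Growth

variable {G X : Type*} [Group G] [MetricSpace X] [MulAction G X]

/-- The two exponential bounds squeeze `log gr / r`, so the limsup is a limit. -/
lemma growthRate_eq {o : X} {w : ℝ} (hw : 0 < w) (h : AsympExp (growth G o) w) :
    growthRate G o = w := by
  obtain ⟨M₀, M₁, h₀, h₁, hM⟩ := h
  have hlim : ∀ M : ℝ, Tendsto (fun r : ℝ => Real.log M / r + Real.log w) atTop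
      (𝓝 (Real.log w)) := fun M => by
    simpa using (tendsto_const_nhds.div_atTop tendsto_id).add_const (Real.log w)
  have key : Tendsto (fun r : ℝ => Real.log (growth G o r) / r) atTop (𝓝 (Real.log w)) := by
    refine tendsto_of_tendsto_of_tendsto_of_le_of_le' (hlim M₀) (hlim M₁) ?_ ?_
    · filter_upwards [eventually_ge_atTop 1] with r hr
      have hp : 0 < w ^ r := Real.rpow_pos_of_pos hw r
      have := Real.log_le_log (by positivity) (hM r hr).1
      rw [Real.log_mul h₀.ne' hp.ne', Real.log_rpow hw] at this
      rw [div_add' _ _ _ (by positivity)]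
      gcongr
      linarith
    · filter_upwards [eventually_ge_atTop 1] with r hr
      have hp : 0 < w ^ r := Real.rpow_pos_of_pos hw r
      have := Real.log_le_log (lt_of_lt_of_le (by positivity) (hM r hr).1) (hM r hr).2
      rw [Real.log_mul h₁.ne' hp.ne', Real.log_rpow hw] at this
      rw [div_add' _ _ _ (by positivity)]
      gcongr
      linarith
  rw [growthRate, key.limsup_eq, Real.exp_log hw]

variable [ProperSpace X] [ProperlyDiscontinuousSMul G X]

lemma doubleCosetGrowth_le_growth (H K : Subgroup G) (o : X) (r : ℝ) :
    doubleCosetGrowth H K o r ≤ growth G o r := by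
  refine (Set.ncard_le_ncard ?_ ((finite_setOf_dist_le o r).image
    fun x => DoubleCoset.doubleCoset x (H : Set G) (K : Set G))).trans
      (Set.ncard_image_le (finite_setOf_dist_le o r))
  rintro _ ⟨⟨g, rfl⟩, x, hx, hr⟩
  exact ⟨x, hr.le, DoubleCoset.doubleCoset_eq_of_mem hx⟩

theorem IsControlled.doubleCosetGrowthComparable {H K : Subgroup G} {o : X}
    (h : IsControlled H K o univ) : DoubleCosetGrowthComparable H K o := by
  have main : ∃ δ r₀ : ℝ, 0 < δ ∧ 0 < r₀ ∧ ∀ r : ℝ, r₀ < r →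
      δ * (growth G o (r - r₀) : ℝ) ≤ (doubleCosetGrowth H K o r : ℝ) := by
    obtain ⟨r₀, N, hN⟩ := h
    -- `N + 1` avoids dividing by zero, and `max r₀ 1` makes the shift positive.
    refine ⟨1 / (N + 1), max r₀ 1, by positivity, by positivity, fun r hr => ?_⟩
    have h1 : growth G o (r - max r₀ 1) ≤ N * doubleCosetGrowth H K o r :=
      (Set.ncard_le_ncard (fun g hg => And.intro trivial
        (le_trans hg (sub_le_sub_left (le_max_left r₀ 1) r)))
        (IsControlled.finite_ball o univ _)).trans
        (hN r (lt_of_le_of_lt (by positivity) hr))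
    have h2 : (growth G o (r - max r₀ 1) : ℝ) ≤ N * doubleCosetGrowth H K o r := by
      exact_mod_cast h1
    rw [one_div, inv_mul_le_iff₀ (by positivity)]
    linarith [Nat.cast_nonneg (α := ℝ) (doubleCosetGrowth H K o r)]
  refine ⟨main, ?_⟩
  rintro ⟨w, hw, hexp⟩
  have hw0 : 0 < w := by linarith
  rw [growthRate_eq hw0 hexp]
  obtain ⟨δ, r₀, hδ, hr₀, hmain⟩ := main
  obtain ⟨M₀, M₁, h₀, h₁, hM⟩ := hexp
  -- Up to `r₀ + 1` it suffices that at least one double coset is counted; beyond, `r - r₀ ≥ 1` and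
  -- the lower growth bound applies.
  refine ⟨min (w ^ (-(r₀ + 1))) (δ * M₀ * w ^ (-r₀)), M₁, by positivity, h₁, fun r hr =>
    ⟨?_, le_trans (by exact_mod_cast doubleCosetGrowth_le_growth H K o r) (hM r hr).2⟩⟩
  have hp : 0 < w ^ r := Real.rpow_pos_of_pos hw0 r
  rcases le_or_gt r (r₀ + 1) with hle | hgt
  · calc _ ≤ w ^ (-(r₀ + 1)) * w ^ r := by gcongr; exact min_le_left _ _
      _ = w ^ (-(r₀ + 1) + r) := (Real.rpow_add hw0 _ _).symm
      _ ≤ 1 := Real.rpow_le_one_of_one_le_of_nonpos hw.le (by linarith)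
      _ ≤ doubleCosetGrowth H K o r := by
        exact_mod_cast doubleCosetGrowth_pos H K o (by linarith)
  · calc _ ≤ δ * M₀ * w ^ (-r₀) * w ^ r := by gcongr; exact min_le_right _ _
      _ = δ * (M₀ * w ^ (r - r₀)) := by
        rw [sub_eq_neg_add, Real.rpow_add hw0]; ring
      _ ≤ δ * growth G o (r - r₀) := by gcongr; exact (hM _ (by linarith)).1
      _ ≤ doubleCosetGrowth H K o r := hmain r (by linarith)

end Growth

end DoubleCosetGrowth

theorem theorem1p5 {G X : Type*} [Group G] [MetricSpace X] [ProperSpace X]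
    [MulAction G X] [IsIsometricSMul G X] [ProperlyDiscontinuousSMul G X]
    (hX : DoubleCosetGrowth.IsGeodesicSpace X) (hG : DoubleCosetGrowth.IsNonElementary G) (o : X) :
    -- the horofunction boundary
    ((∃ g : G, DoubleCosetGrowth.IsContractingElement X g) →
      ∀ H K : Subgroup G,
        DoubleCosetGrowth.IsSecondType (DoubleCosetGrowth.finiteDifference o) H o →
        DoubleCosetGrowth.IsSecondType (DoubleCosetGrowth.finiteDifference o) K o →
        DoubleCosetGrowth.DoubleCosetGrowthComparable H K o) ∧
    -- a convergence boundary
    (∀ (Y : Type*) [TopologicalSpace Y] [CompactSpace Y] [TopologicalSpace.MetrizableSpace Y]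
        (ι : X → Y) (P : Setoid (DoubleCosetGrowth.bdry ι)),
      DoubleCosetGrowth.IsConvergenceCompactification ι P →
      (∃ g : G, DoubleCosetGrowth.IsMinimalNonPinchedContracting P g) →
      ∀ H K : Subgroup G,
        DoubleCosetGrowth.IsSecondType P H o →
        DoubleCosetGrowth.IsSecondType P K o →
        DoubleCosetGrowth.DoubleCosetGrowthComparable H K o) := by
  refine ⟨?_, ?_⟩
  · rintro ⟨f, γ, hf⟩ H K hH hK
    obtain ⟨τ, l, C, h⟩ := hf.exists_isAxis
    obtain ⟨θ, P⟩ := h.exists_isProjectionSystem hX hG o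
    exact (P.isControlled_univ (h.exists_bounded_projection hX hG o hH)
      (h.exists_bounded_projection hX hG o hK)).doubleCosetGrowthComparable
  · rintro Y _ _ _ ι P hP ⟨f, γ, hf, -, -⟩ H K hH hK
    obtain ⟨τ, l, C, h⟩ := hf.exists_isAxis
    obtain ⟨θ, Q⟩ := h.exists_isProjectionSystem hX hG o
    exact (Q.isControlled_univ (hP.exists_bounded_projection hX hG hf o hH)
      (hP.exists_bounded_projection hX hG hf o hK)).doubleCosetGrowthComparable
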